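/- For $\tau\in\mathbb C$ with $\operatorname{Im}\tau>0$ put $q^x:=e^{2\pi i\tau x}$ $(x\in\mathbb R)$, and for $z,z_1,z_2,z_3,t\in\mathbb C$ let $$\theta_{k,m}(\tau,z):=\sum_{j\in\mathbb Z}e^{2\pi im(j+\frac{k}{2m})z}\,q^{m(j+\frac{k}{2m})^2},\qquad \vartheta_{ab}(\tau,z):=\sum_{n\in\mathbb Z}e^{\pi i(n+\frac a2)^2\tau+2\pi i(n+\frac a2)(z+\frac b2)}\quad(a,b\in\{0,1\}),$$ let $\eta(\tau):=q^{1/24}\prod_{n\ge1}(1-q^n)$, and let $\Phi^{[m,s]}:=\Phi^{[m,s]}_1-\Phi^{[m,s]}_2$, where $$\Phi^{[m,s]}_1(\tau,z_1,z_2,t):=e^{-2\pi imt}\sum_{j\in\mathbb Z}\frac{e^{2\pi imj(z_1+z_2)+2\pi isz_1}q^{mj^2+sj}}{1-e^{2\pi iz_1}q^j},$$ $$\Phi^{[m,s]}_2(\tau,z_1,z_2,t):=e^{-2\pi imt}\sum_{j\in\mathbb Z}\frac{e^{-2\pi imj(z_1+z_2)-2\pi isz_2}q^{mj^2+sj}}{1-e^{-2\pi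 iz_2}q^j}.$$ For integers $j,k\ge 1$ put $$\begin{aligned}P^{[m]}_{j,k}(z_1,z_2,z_3):={}&e^{2\pi ij(z_1-z_2)}e^{\pi i(2mj-k)(z_1-2z_2-z_3)}+e^{-2\pi ij(z_1-z_2)}e^{-\pi i(2mj-k)(z_1-2z_2-z_3)}\\&-e^{2\pi ij(z_1-z_2)}e^{\pi i(2mj-k)(z_1+z_3)}-e^{-2\pi ij(z_1-z_2)}e^{-\pi i(2mj-k)(z_1+z_3)}.\end{aligned}$$ **Proposition.** Let $m>0$ with $2m\in\mathbb Z$, let $\operatorname{Im}\tau>0$, and let $z_1,z_2,z_3\in\mathbb C$ be such that none of $z_1$, $z_2$, $z_3$, $z_1-z_2-z_3$ lies in $\mathbb Z+\mathbb Z\tau$. Then the series over $j$ below converges absolutely, and $$\begin{aligned} &\theta_{0,m+1}\Big(\tau,\tfrac{(z_1-z_2)+m(z_1+z_3)}{m+1}\Big)\Phi^{[m,0]}(\tau,z_1,-z_3,0)\\ &-\theta_{0,m+1}\Big(\tau,\tfrac{(z_1-z_2)+m(z_1-2z_2-z_3)}{m+1}\Big)\Phi^{[m,0]}(\tau,z_2,z_1-z_2-z_3,0)\\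 &+\sum_{j>0}\sum_{k=1}^{2mj}q^{(m+1)j^2}q^{-\frac{k^2}{4m}}P^{[m]}_{j,k}(z_1,z_2,z_3)\,[\theta_{k,m}-\theta_{-k,m}](\tau,z_1-z_3)\\ ={}&i\,\theta_{0,m+1}\Big(\tau,\tfrac{(z_1+z_2)+m(z_1-z_3)}{m+1}\Big)\frac{\eta(\tau)^3\,\vartheta_{11}(\tau,z_1-z_2)}{\vartheta_{11}(\tau,z_1)\,\vartheta_{11}(\tau,z_2)}\\ &+i\,\theta_{0,m+1}\Big(\tau,\tfrac{(z_1-z_2-2z_3)+m(z_1-z_3)}{m+1}\Big)\frac{\eta(\tau)^3\,\vartheta_{11}(\tau,z_1-z_2)}{\vartheta_{11}(\tau,z_3)\,\vartheta_{11}(\tau,z_1-z_2-z_3)}. \end{aligned}$$ -/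

import Mathlib

open Complex

noncomputable section

/-- `qpow τ x` is `q ^ x` for `q = e^{2πiτ}`, that is, `e^{2πiτx}`. -/
def qpow (τ : ℂ) (x : ℝ) : ℂ := cexp (2 * Real.pi * I * τ * x)

/-- Jacobi's theta function
`θ_{k,m}(τ,z) = ∑_{j ∈ ℤ} e^{2πim(j + k/(2m))z} q^{m(j + k/(2m))²}`. -/
def jacobiThetaKM (k m : ℝ) (τ z : ℂ) : ℂ :=
  ∑' j : ℤ, cexp (2 * Real.pi * I * m * (j + k / (2 * m)) * z) *
    qpow τ (m * (j + k / (2 * m)) ^ 2)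

/-- Mumford's theta functions
`ϑ_{ab}(τ,z) = ∑_{n ∈ ℤ} e^{πi(n + a/2)²τ + 2πi(n + a/2)(z + b/2)}` for `a, b ∈ {0,1}`. -/
def mumfordTheta (a b : Fin 2) (τ z : ℂ) : ℂ :=
  ∑' n : ℤ, cexp (Real.pi * I * (n + (a : ℕ) / 2) ^ 2 * τ +
    2 * Real.pi * I * (n + (a : ℕ) / 2) * (z + (b : ℕ) / 2))

/-- The function `Φ₁^{[m,s]}(τ, z₁, z₂, t)`. -/
def mockPhi₁ (m s : ℝ) (τ z₁ z₂ t : ℂ) : ℂ :=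
  cexp (-2 * Real.pi * I * m * t) *
    ∑' j : ℤ, cexp (2 * Real.pi * I * m * j * (z₁ + z₂) + 2 * Real.pi * I * s * z₁) *
      qpow τ (m * j ^ 2 + s * j) / (1 - cexp (2 * Real.pi * I * z₁) * qpow τ j)

/-- The function `Φ₂^{[m,s]}(τ, z₁, z₂, t)`. -/
def mockPhi₂ (m s : ℝ) (τ z₁ z₂ t : ℂ) : ℂ :=
  cexp (-2 * Real.pi * I * m * t) *
    ∑' j : ℤ, cexp (-2 * Real.pi * I * m * j * (z₁ + z₂) - 2 * Real.pi * I * s * z₂) *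
      qpow τ (m * j ^ 2 + s * j) / (1 - cexp (-2 * Real.pi * I * z₂) * qpow τ j)

/-- The mock theta function `Φ^{[m,s]} = Φ₁^{[m,s]} - Φ₂^{[m,s]}`. -/
def mockPhi (m s : ℝ) (τ z₁ z₂ t : ℂ) : ℂ :=
  mockPhi₁ m s τ z₁ z₂ t - mockPhi₂ m s τ z₁ z₂ t

/-- The exponential polynomial `P^{[m]}_{j,k}(z₁, z₂, z₃)`. -/
def coeffP (m : ℝ) (j k : ℕ) (z₁ z₂ z₃ : ℂ) : ℂ :=
  cexp (2 * Real.pi * I * j * (z₁ - z₂)) *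
      cexp (Real.pi * I * (2 * m * j - k) * (z₁ - 2 * z₂ - z₃))
    + cexp (-2 * Real.pi * I * j * (z₁ - z₂)) *
      cexp (-Real.pi * I * (2 * m * j - k) * (z₁ - 2 * z₂ - z₃))
    - cexp (2 * Real.pi * I * j * (z₁ - z₂)) *
      cexp (Real.pi * I * (2 * m * j - k) * (z₁ + z₃))
    - cexp (-2 * Real.pi * I * j * (z₁ - z₂)) *
      cexp (-Real.pi * I * (2 * m * j - k) * (z₁ + z₃))

/-- `z` does not lie in the lattice `ℤ + ℤτ`. -/
def OffLattice (τ z : ℂ) : Prop := ∀ a b : ℤ, z ≠ a + b * τ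

/-- The `j`-th term `∑_{k=1}^{2mj} q^{(m+1)j²} q^{-k²/(4m)} P^{[m]}_{j,k} [θ_{k,m} - θ_{-k,m}]`
of the double series, where `N = 2m`. -/
def doubleSumTerm (m : ℝ) (N : ℕ) (τ z₁ z₂ z₃ : ℂ) (j : ℕ) : ℂ :=
  ∑ k ∈ Finset.Icc 1 (N * j),
    qpow τ ((m + 1) * j ^ 2) * qpow τ (-(k ^ 2 / (4 * m))) * coeffP m j k z₁ z₂ z₃ *
      (jacobiThetaKM k m τ (z₁ - z₃) - jacobiThetaKM (-k) m τ (z₁ - z₃))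

end

/-!
Write `e(z) = e^{2πiz}`, `q^x = e(xτ)`, `Θ_c(x) = ∑_a e(ax) q^{ca²}`, and put `w = z₁ - z₃`,
`u = z₁ - z₂`, `z₄ = z₁ - z₂ - z₃`, `r = z₁ + z₃`, `p = z₁ - 2z₂ - z₃`. Up to a reflection of the
summation index, the two functions `Φ^{[m,0]}` are the differences of the Appell sums
`G(w, z) = ∑_j e(mjw) q^{mj²} / (1 - e(z) q^j)` at `(w, z₁)`, `(-w, z₃)` and at `(w, z₄)`,
`(-w, -z₂)`. The quantity `2z - w` is `r` for the first pair and `p` for the second (with `-w` in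
place of `w` for the second member of each pair), so that both members of a pair come with the same
factor `Θ_{m+1}(u + m(2z - w))`.

In the product `∑_a e(a(u + m(2z - w))) q^{(m+1)a²} · G(w, z)`, write `x = e(z) q^j` and replace
`1 / (1 - x)` by a finite geometric sum plus `x^{-2ma} / (1 - x)`. The geometric sums produce finite
combinations of `θ_{k,m}(w)`, and after the substitution `j = a + n` the remaining part is the
double series `A(u, w, z) = ∑_{a,n} e(au + mnw) q^{a² + mn²} / (1 - e(z) q^{a+n})`
(`hasSum_thetaCorrection`). Over the four Appell sums the finite combinations for `a` and `-a` add
up to minus the `j = |a|` term of the double sum in the statement (`thetaCorrection_total`).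

The double series combine in pairs with `z + z' = u`: summed over `a` first,
`A(u, w, z) + A(u, -w, z')` is a theta series in `n` whose coefficients are Appell sums of level
one at `(z + nτ, z' - nτ)` (`doubleAppell_add`). The latter are quotients of theta functions by the
denominator identity `f(s, t) ϑ₁₁(s) ϑ₁₁(t) = -i η³ ϑ₁₁(s + t)` (`appellSum_mul_mumfordTheta`),
so that the sum over `n` is again a `Θ_{m+1}`.

The denominator identity follows from Liouville's theorem: for a fixed sum `u = s + t` the left-hand
side is a doubly periodic function of `s` with removable singularities. Its constant value is found
at `s = 0` from `ϑ₁₁'(0) = -2πη³` (`hasDerivAt_mumfordTheta_zero`), which is Jacobi's series for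
`∏ (1 - q^n)³` (`hasSum_jacobi_cube`), obtained here as a limit of finite triple products.
-/

open Filter Topology

/-! ### The exponential function and the period lattice -/

/-- The exponential `e(z) = e^{2πiz}`, so that `q^x = e(xτ)`. -/
noncomputable def qexp (z : ℂ) : ℂ := cexp (2 * Real.pi * I * z)

lemma qexp_add (x y : ℂ) : qexp (x + y) = qexp x * qexp y := by
  rw [qexp, qexp, qexp, ← Complex.exp_add]; ring_nf

lemma qexp_neg (x : ℂ) : qexp (-x) = (qexp x)⁻¹ := by
  rw [qexp, qexp, ← Complex.exp_neg]; ring_nf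

lemma qexp_sub (x y : ℂ) : qexp (x - y) = qexp x * (qexp y)⁻¹ := by
  rw [sub_eq_add_neg, qexp_add, qexp_neg]

lemma qexp_zero : qexp 0 = 1 := by simp [qexp]

lemma qexp_ne_zero (x : ℂ) : qexp x ≠ 0 := Complex.exp_ne_zero _

lemma qexp_eq_one_iff {z : ℂ} : qexp z = 1 ↔ ∃ n : ℤ, z = n := by
  rw [qexp, Complex.exp_eq_one_iff]
  refine exists_congr fun n => ?_
  rw [mul_comm, mul_left_inj' Complex.two_pi_I_ne_zero]

lemma qexp_int (n : ℤ) : qexp n = 1 := qexp_eq_one_iff.2 ⟨n, rfl⟩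

lemma qexp_half : qexp (1 / 2) = -1 := by
  rw [qexp, ← Complex.exp_pi_mul_I]; ring_nf

lemma qexp_eq_of_eq_add_int {x y : ℂ} (n : ℤ) (h : x = y + n) : qexp x = qexp y := by
  rw [h, qexp_add, qexp_int, mul_one]

lemma neg_qexp (x : ℂ) : -qexp x = qexp (x + 1 / 2) := by
  rw [qexp_add, qexp_half, mul_neg_one]

lemma norm_qexp (z : ℂ) : ‖qexp z‖ = Real.exp (-2 * Real.pi * z.im) := by
  rw [qexp, Complex.norm_exp]; simp

lemma differentiable_qexp : Differentiable ℂ qexp := by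
  unfold qexp; fun_prop

lemma hasDerivAt_qexp (z : ℂ) : HasDerivAt qexp (2 * Real.pi * I * qexp z) z := by
  have h := ((hasDerivAt_id z).const_mul (2 * Real.pi * I)).cexp
  rw [mul_one, mul_comm (cexp _)] at h
  exact h

lemma norm_qexp_lt_one {τ : ℂ} (hτ : 0 < τ.im) : ‖qexp τ‖ < 1 := by
  rw [norm_qexp, Real.exp_lt_one_iff]
  nlinarith [mul_pos Real.pi_pos hτ]

lemma offLattice_iff {τ z : ℂ} : OffLattice τ z ↔ ∀ a : ℤ, 1 - qexp (z + a * τ) ≠ 0 := by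
  constructor
  · intro h a ha
    obtain ⟨n, hn⟩ := qexp_eq_one_iff.1 (sub_eq_zero.1 ha).symm
    refine h n (-a) ?_
    push_cast
    linear_combination hn
  · intro h a b hab
    refine h (-b) (sub_eq_zero.2 (qexp_eq_one_iff.2 ⟨a, ?_⟩).symm)
    rw [hab]; push_cast; ring

lemma OffLattice.neg {τ z : ℂ} (h : OffLattice τ z) : OffLattice τ (-z) := by
  intro a b hab
  refine h (-a) (-b) ?_
  push_cast
  linear_combination -hab

lemma OffLattice.add_int_mul {τ z : ℂ} (h : OffLattice τ z) (n : ℤ) :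
    OffLattice τ (z + n * τ) := by
  intro a b hab
  refine h a (b - n) ?_
  push_cast
  linear_combination hab

lemma OffLattice.sub_int_mul {τ z : ℂ} (h : OffLattice τ z) (n : ℤ) :
    OffLattice τ (z - n * τ) := by
  simpa [sub_eq_add_neg] using h.add_int_mul (-n)

lemma OffLattice.add_one {τ z : ℂ} (h : OffLattice τ z) : OffLattice τ (z + 1) := by
  intro a b hab
  refine h (a - 1) b ?_
  push_cast
  linear_combination hab

lemma OffLattice.sub_one {τ z : ℂ} (h : OffLattice τ z) : OffLattice τ (z - 1) := by
  intro a b hab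
  refine h (a + 1) b ?_
  push_cast
  linear_combination hab

/-- The reciprocals `1 / (1 - e(s) q^a)` that are finite at `s₀` are bounded uniformly in `a ∈ ℤ`
and in `s` near `s₀`: they tend to `1` and to `0` as `a → ±∞`. -/
lemma exists_bound_inv_one_sub_qexp {τ : ℂ} (hτ : 0 < τ.im) (s₀ : ℂ) :
    ∃ C : ℝ, ∀ᶠ s in 𝓝 s₀, ∀ a : ℤ, 1 - qexp (s₀ + a * τ) ≠ 0 →
      ‖(1 - qexp (s + a * τ))⁻¹‖ ≤ C := by
  obtain ⟨A, hA⟩ := exists_nat_gt ((|s₀.im| + 2) / τ.im)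
  rw [div_lt_iff₀ hτ] at hA
  set F : Finset ℤ := Finset.Icc (-(A : ℤ)) A with hF
  set b : ℤ → ℝ := fun a => ‖(1 - qexp (s₀ + a * τ))⁻¹‖ + 1 with hb
  have hb0 : ∀ a, 0 ≤ b a := fun a => by positivity
  refine ⟨2 + ∑ a ∈ F, b a, ?_⟩
  have hfin : ∀ᶠ s in 𝓝 s₀, ∀ a ∈ F, 1 - qexp (s₀ + a * τ) ≠ 0 →
      ‖(1 - qexp (s + a * τ))⁻¹‖ ≤ b a := by
    rw [Filter.eventually_all_finset]
    intro a _
    by_cases h : 1 - qexp (s₀ + a * τ) = 0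
    · exact .of_forall fun s hs => (hs h).elim
    have hc : ContinuousAt (fun s => ‖(1 - qexp (s + a * τ))⁻¹‖) s₀ := by
      refine ContinuousAt.norm (ContinuousAt.inv₀ ?_ h)
      exact continuousAt_const.sub
        (differentiable_qexp.continuous.continuousAt.comp (by fun_prop))
    filter_upwards [hc.eventually_lt continuousAt_const (lt_add_one _)] with s hs _ using hs.le
  have him : ∀ᶠ s in 𝓝 s₀, |s.im| < |s₀.im| + 1 :=
    (Complex.continuous_im.abs.continuousAt).eventually_lt continuousAt_const (lt_add_one _)
  have hpi := Real.pi_gt_three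
  have he1 : Real.exp (-1) ≤ 1 / 2 := by
    have := Real.add_one_le_exp (1 : ℝ)
    rw [Real.exp_neg, one_div]
    exact inv_anti₀ (by norm_num) (by linarith)
  filter_upwards [hfin, him] with s hs1 hs2 a ha
  have hsum : 0 ≤ ∑ a ∈ F, b a := Finset.sum_nonneg fun a _ => hb0 a
  have hs3 := abs_lt.1 hs2
  by_cases haF : a ∈ F
  · have := Finset.single_le_sum (f := b) (fun a _ => hb0 a) haF
    linarith [hs1 a haF ha]
  · suffices h : 1 / 2 ≤ ‖1 - qexp (s + a * τ)‖ by
      rw [norm_inv]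
      have := inv_anti₀ (by norm_num) h
      norm_num at this
      linarith
    have hn : ‖qexp (s + a * τ)‖ = Real.exp (-2 * Real.pi * (s.im + a * τ.im)) := by
      rw [norm_qexp]; simp
    rw [hF, Finset.mem_Icc, not_and_or, not_le, not_le] at haF
    rcases haF with h | h
    · have h' : (a : ℝ) ≤ -A := by exact_mod_cast h.le
      have h2 : s.im + a * τ.im ≤ -1 := by nlinarith
      have h3 : (2 : ℝ) ≤ ‖qexp (s + a * τ)‖ := by
        rw [hn]
        have := Real.add_one_le_exp (-2 * Real.pi * (s.im + a * τ.im))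
        nlinarith
      have := norm_sub_norm_le (qexp (s + a * τ)) 1
      rw [norm_sub_rev, norm_one] at this
      linarith
    · have h' : (A : ℝ) ≤ a := by exact_mod_cast h.le
      have h2 : 1 ≤ s.im + a * τ.im := by nlinarith
      have h3 : ‖qexp (s + a * τ)‖ ≤ 1 / 2 := by
        rw [hn]
        refine le_trans (Real.exp_le_exp.2 ?_) he1
        nlinarith
      have := norm_sub_norm_le 1 (qexp (s + a * τ))
      rw [norm_one] at this
      linarith

lemma OffLattice.exists_bound {τ z : ℂ} (hτ : 0 < τ.im) (h : OffLattice τ z) :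
    ∃ C : ℝ, ∀ a : ℤ, ‖(1 - qexp (z + a * τ))⁻¹‖ ≤ C := by
  obtain ⟨C, hC⟩ := exists_bound_inv_one_sub_qexp hτ z
  exact ⟨C, fun a => hC.self_of_nhds a (offLattice_iff.1 h a)⟩

/-- Lattice points are isolated. -/
lemma eventually_offLattice {τ : ℂ} (hτ : 0 < τ.im) (z : ℂ) :
    ∀ᶠ s in 𝓝[≠] z, OffLattice τ s := by
  obtain ⟨A, hA⟩ := exists_nat_gt ((|z.im| + 1) / τ.im)
  rw [div_lt_iff₀ hτ] at hA
  have hfin : ∀ᶠ s in 𝓝[≠] z, ∀ a ∈ Finset.Icc (-(A : ℤ)) A, qexp (s + a * τ) ≠ 1 := by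
    rw [Filter.eventually_all_finset]
    intro a _
    have hd : HasDerivAt (fun s => qexp (s + a * τ)) (2 * Real.pi * I * qexp (z + a * τ)) z :=
      (hasDerivAt_qexp _).comp_add_const z _
    exact hd.eventually_ne (mul_ne_zero Complex.two_pi_I_ne_zero (qexp_ne_zero _))
  have him : ∀ᶠ s in 𝓝[≠] z, |s.im| < |z.im| + 1 :=
    ((Complex.continuous_im.abs.continuousAt).eventually_lt continuousAt_const
      (lt_add_one _)).filter_mono nhdsWithin_le_nhds
  filter_upwards [hfin, him] with s hs1 hs2
  rw [offLattice_iff]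
  intro a ha
  have ha1 : qexp (s + a * τ) = 1 := (sub_eq_zero.1 ha).symm
  by_cases haF : a ∈ Finset.Icc (-(A : ℤ)) A
  · exact hs1 a haF ha1
  · obtain ⟨n, hn⟩ := qexp_eq_one_iff.1 ha1
    have h2 : s.im + a * τ.im = 0 := by simpa using congrArg Complex.im hn
    have hs3 := abs_lt.1 hs2
    rw [Finset.mem_Icc, not_and_or, not_le, not_le] at haF
    rcases haF with h | h
    · have h' : (a : ℝ) ≤ -A := by exact_mod_cast h.le
      nlinarith
    · have h' : (A : ℝ) ≤ a := by exact_mod_cast h.le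
      nlinarith

lemma OffLattice.eventually {τ z : ℂ} (hτ : 0 < τ.im) (h : OffLattice τ z) :
    ∀ᶠ s in 𝓝 z, OffLattice τ s := by
  have h1 := eventually_nhdsWithin_iff.1 (eventually_offLattice hτ z)
  filter_upwards [h1] with s hs
  rcases eq_or_ne s z with rfl | hne
  · exact h
  · exact hs hne

lemma summable_qexp {τ : ℂ} (hτ : 0 < τ.im) {c : ℝ} (hc : 0 < c) (x : ℂ) :
    Summable fun a : ℤ => qexp (a * x + c * a ^ 2 * τ) := by
  have := (summable_jacobiTheta₂_term_iff x (2 * c * τ)).2 (by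
    have : (2 * (c : ℂ) * τ).im = 2 * c * τ.im := by simp
    rw [this]; positivity)
  refine this.congr fun a => ?_
  rw [jacobiTheta₂_term, qexp]
  ring_nf

/-- The theta series `Θ_c(x) = ∑_{a ∈ ℤ} e(ax) q^{ca²}`. -/
noncomputable def thetaSeries (c : ℝ) (τ x : ℂ) : ℂ := ∑' a : ℤ, qexp (a * x + c * a ^ 2 * τ)

lemma thetaSeries_neg (c : ℝ) (τ x : ℂ) : thetaSeries c τ (-x) = thetaSeries c τ x := by
  rw [thetaSeries, ← (Equiv.neg ℤ).tsum_eq]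
  refine tsum_congr fun a => ?_
  simp

lemma qpow_eq (τ : ℂ) (x : ℝ) : qpow τ x = qexp (x * τ) := by
  rw [qpow, qexp]; ring_nf

lemma jacobiThetaKM_zero {c : ℝ} (hc : c ≠ 0) (τ x : ℂ) :
    jacobiThetaKM 0 c τ (x / c) = thetaSeries c τ x := by
  have hc' : (c : ℂ) ≠ 0 := by exact_mod_cast hc
  refine tsum_congr fun j => ?_
  rw [qpow_eq, qexp, qexp, ← Complex.exp_add]
  congr 1
  push_cast
  field_simp
  ring

/-- `θ_{k,m}` is, up to an exponential factor, a theta series with shifted argument. -/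
lemma jacobiThetaKM_eq {m : ℝ} (hm : m ≠ 0) (k : ℝ) (τ w : ℂ) :
    jacobiThetaKM k m τ w =
      qexp (k * w / 2 + k ^ 2 / (4 * m) * τ) * thetaSeries m τ (m * w + k * τ) := by
  have hm' : (m : ℂ) ≠ 0 := by exact_mod_cast hm
  rw [thetaSeries, ← tsum_mul_left]
  refine tsum_congr fun j => ?_
  rw [qpow_eq, qexp, qexp, qexp, ← Complex.exp_add, ← Complex.exp_add]
  congr 1
  push_cast
  field_simp
  ring

lemma jacobiThetaKM_neg {m : ℝ} (hm : m ≠ 0) (k : ℝ) (τ w : ℂ) :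
    jacobiThetaKM (-k) m τ w = jacobiThetaKM k m τ (-w) := by
  rw [jacobiThetaKM_eq hm, jacobiThetaKM_eq hm, ← thetaSeries_neg]
  congr 2 <;> push_cast <;> ring

/-! ### Jacobi's series for the cube of the Euler function -/

/-- The partial products `(1 - q)(1 - q²)⋯(1 - q^n)` of the Euler function. -/
noncomputable def eulerProd (q : ℂ) (n : ℕ) : ℂ := ∏ i ∈ Finset.range n, (1 - q ^ (i + 1))

/-- `1 / ((1 - q)⋯(1 - q^k))` as a function of `k ∈ ℤ`, which vanishes for `k < 0`. -/
noncomputable def invEulerProd (q : ℂ) (k : ℤ) : ℂ :=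
  if k < 0 then 0 else (eulerProd q k.toNat)⁻¹

lemma one_sub_pow_ne_zero_of_norm_lt_one {q : ℂ} (hq : ‖q‖ < 1) (n : ℕ) :
    1 - q ^ (n + 1) ≠ 0 := by
  intro h
  have h1 : ‖q ^ (n + 1)‖ = 1 := by rw [← sub_eq_zero.1 h, norm_one]
  rw [norm_pow] at h1
  exact (pow_lt_one₀ (norm_nonneg q) hq n.succ_ne_zero).ne h1

lemma eulerProd_ne_zero {q : ℂ} (hq : ‖q‖ < 1) (n : ℕ) : eulerProd q n ≠ 0 :=
  Finset.prod_ne_zero_iff.2 fun i _ => one_sub_pow_ne_zero_of_norm_lt_one hq i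

lemma eulerProd_succ (q : ℂ) (n : ℕ) :
    eulerProd q (n + 1) = eulerProd q n * (1 - q ^ (n + 1)) :=
  Finset.prod_range_succ _ _

lemma invEulerProd_natCast (q : ℂ) (n : ℕ) : invEulerProd q n = (eulerProd q n)⁻¹ := by
  simp [invEulerProd]

lemma invEulerProd_sub_one {q : ℂ} (hq : ‖q‖ < 1) (k : ℤ) :
    invEulerProd q (k - 1) = (1 - q ^ k) * invEulerProd q k := by
  rcases lt_trichotomy k 0 with h | rfl | h
  · simp [invEulerProd, h, show k - 1 < 0 by omega]
  · simp [invEulerProd]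
  · obtain ⟨n, rfl⟩ : ∃ n : ℕ, k = (n + 1 : ℕ) := ⟨(k - 1).toNat, by omega⟩
    rw [show ((n + 1 : ℕ) : ℤ) - 1 = n by push_cast; ring, invEulerProd_natCast,
      invEulerProd_natCast, eulerProd_succ, zpow_natCast]
    have h1 := eulerProd_ne_zero hq n
    have h2 := one_sub_pow_ne_zero_of_norm_lt_one hq n
    field_simp

/-- The coefficient `(-1)^n q^{n(n+1)/2} \binom{2N}{N+n}_q` of `x^n` in the finite triple product
`∏_{k=1}^N (1 - x q^k)(1 - x⁻¹ q^{k-1})`. -/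
noncomputable def finiteTripleCoeff (τ : ℂ) (N : ℕ) (n : ℤ) : ℂ :=
  qexp (n / 2 + n * (n + 1) / 2 * τ) *
    (eulerProd (qexp τ) (2 * N) * invEulerProd (qexp τ) (N + n) * invEulerProd (qexp τ) (N - n))

lemma qexp_zpow (n : ℤ) (x : ℂ) : qexp x ^ n = qexp (n * x) := by
  rw [qexp, qexp, ← Complex.exp_int_mul]; ring_nf

/-- The recurrence that expresses multiplication of the finite triple product by
`(1 - x q^{N+1})(1 - x⁻¹ q^N)`. -/
lemma finiteTripleCoeff_succ {τ : ℂ} (hτ : 0 < τ.im) (N : ℕ) (n : ℤ) :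
    finiteTripleCoeff τ (N + 1) n =
      (1 + qexp τ ^ (2 * N + 1)) * finiteTripleCoeff τ N n
        - qexp τ ^ (N + 1) * finiteTripleCoeff τ N (n - 1)
        - qexp τ ^ N * finiteTripleCoeff τ N (n + 1) := by
  have hq := norm_qexp_lt_one hτ
  set q := qexp τ with hqdef
  have hq0 : q ≠ 0 := qexp_ne_zero _
  have r1 : invEulerProd q (N + n) =
      (1 - q ^ N * q ^ n * q) * invEulerProd q ((N + 1 : ℕ) + n) := by
    rw [show (N : ℤ) + n = ((N + 1 : ℕ) + n) - 1 by push_cast; ring, invEulerProd_sub_one hq,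
      show ((N + 1 : ℕ) : ℤ) + n = N + n + 1 by push_cast; ring, zpow_add₀ hq0, zpow_add₀ hq0]
    simp
  have r2 : invEulerProd q (N - n) =
      (1 - q ^ N / q ^ n * q) * invEulerProd q ((N + 1 : ℕ) - n) := by
    rw [show (N : ℤ) - n = ((N + 1 : ℕ) - n) - 1 by push_cast; ring, invEulerProd_sub_one hq,
      show ((N + 1 : ℕ) : ℤ) - n = N - n + 1 by push_cast; ring, zpow_add₀ hq0, zpow_sub₀ hq0]
    simp
  have r3 : invEulerProd q (N + (n - 1)) = (1 - q ^ N * q ^ n) * invEulerProd q (N + n) := by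
    rw [show (N : ℤ) + (n - 1) = (N + n) - 1 by ring, invEulerProd_sub_one hq, zpow_add₀ hq0]
    simp
  have r4 : invEulerProd q (N - (n + 1)) = (1 - q ^ N / q ^ n) * invEulerProd q (N - n) := by
    rw [show (N : ℤ) - (n + 1) = (N - n) - 1 by ring, invEulerProd_sub_one hq, zpow_sub₀ hq0]
    simp
  have r5 : invEulerProd q (N - (n - 1)) = invEulerProd q ((N + 1 : ℕ) - n) := by
    congr 1; push_cast; ring
  have r6 : invEulerProd q (N + (n + 1)) = invEulerProd q ((N + 1 : ℕ) + n) := by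
    congr 1; push_cast; ring
  have t1 : qexp (((n - 1 : ℤ) : ℂ) / 2 + ((n - 1 : ℤ) : ℂ) * (((n - 1 : ℤ) : ℂ) + 1) / 2 * τ) =
      -(qexp (n / 2 + n * (n + 1) / 2 * τ) / q ^ n) := by
    rw [hqdef, qexp_zpow, div_eq_mul_inv (qexp _), ← qexp_sub, neg_qexp]
    refine qexp_eq_of_eq_add_int (-1) ?_
    push_cast
    ring
  have t2 : qexp (((n + 1 : ℤ) : ℂ) / 2 + ((n + 1 : ℤ) : ℂ) * (((n + 1 : ℤ) : ℂ) + 1) / 2 * τ) =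
      -(qexp (n / 2 + n * (n + 1) / 2 * τ) * q ^ n * q) := by
    rw [hqdef, qexp_zpow, ← qexp_add, ← qexp_add, neg_qexp]
    congr 1
    push_cast
    ring
  have e1 : eulerProd q (2 * (N + 1)) =
      eulerProd q (2 * N) * (1 - q ^ (2 * N + 1)) * (1 - q ^ (2 * N + 2)) := by
    rw [show 2 * (N + 1) = 2 * N + 1 + 1 by ring, eulerProd_succ, eulerProd_succ]
  simp only [finiteTripleCoeff, ← hqdef]
  rw [t1, t2, r3, r4, r5, r6, r1, r2, e1]
  have hB : q ^ n ≠ 0 := zpow_ne_zero _ hq0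
  generalize q ^ n = B at *
  simp only [pow_add, pow_mul', pow_one]
  generalize q ^ N = A
  field_simp
  ring

lemma hasSum_finiteTripleCoeff {τ : ℂ} (hτ : 0 < τ.im) (N : ℕ) :
    HasSum (finiteTripleCoeff τ (N + 1)) 0 ∧
      HasSum (fun n : ℤ => n * finiteTripleCoeff τ (N + 1) n)
        (eulerProd (qexp τ) N * eulerProd (qexp τ) (N + 1)) := by
  -- The recurrence passes to the sums of the coefficients and to their first moments.
  have step : ∀ (N : ℕ) (Z U : ℂ), HasSum (finiteTripleCoeff τ N) Z →
      HasSum (fun n : ℤ => n * finiteTripleCoeff τ N n) U →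
      HasSum (finiteTripleCoeff τ (N + 1))
          ((1 - qexp τ ^ N) * (1 - qexp τ ^ (N + 1)) * Z) ∧
        HasSum (fun n : ℤ => n * finiteTripleCoeff τ (N + 1) n)
          ((1 - qexp τ ^ N) * (1 - qexp τ ^ (N + 1)) * U +
            (qexp τ ^ N - qexp τ ^ (N + 1)) * Z) := by
    intro N Z U hZ hU
    have hZ1 := (Equiv.subRight (1 : ℤ)).hasSum_iff.2 hZ
    have hZ2 := (Equiv.addRight (1 : ℤ)).hasSum_iff.2 hZ
    have hU1 := (Equiv.subRight (1 : ℤ)).hasSum_iff.2 hU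
    have hU2 := (Equiv.addRight (1 : ℤ)).hasSum_iff.2 hU
    constructor
    · convert! ((hZ.mul_left (1 + qexp τ ^ (2 * N + 1))).sub
        (hZ1.mul_left (qexp τ ^ (N + 1)))).sub (hZ2.mul_left (qexp τ ^ N)) using 1
      · ext n
        simpa using finiteTripleCoeff_succ hτ N n
      · ring
    · convert! ((hU.mul_left (1 + qexp τ ^ (2 * N + 1))).sub
        ((hU1.add hZ1).mul_left (qexp τ ^ (N + 1)))).sub
          ((hU2.sub hZ2).mul_left (qexp τ ^ N)) using 1
      · ext n
        simp only [finiteTripleCoeff_succ hτ N n, Function.comp, Equiv.subRight_apply,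
          Equiv.coe_addRight]
        push_cast
        ring
      · ring
  have h0 : ∀ n : ℤ, n ≠ 0 → finiteTripleCoeff τ 0 n = 0 := by
    intro n hn
    rcases hn.lt_or_gt with h | h
    · simp [finiteTripleCoeff, invEulerProd, h]
    · simp [finiteTripleCoeff, invEulerProd, h]
  have h1 : finiteTripleCoeff τ 0 0 = 1 := by
    simp [finiteTripleCoeff, invEulerProd, eulerProd, qexp_zero]
  have hZ0 : HasSum (finiteTripleCoeff τ 0) 1 := by
    simpa [h1] using hasSum_single (f := finiteTripleCoeff τ 0) 0 h0
  have hU0 : HasSum (fun n : ℤ => n * finiteTripleCoeff τ 0 n) 0 := by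
    simpa using hasSum_single (f := fun n : ℤ => n * finiteTripleCoeff τ 0 n) 0
      fun n hn => by simp [h0 n hn]
  induction N with
  | zero =>
    have := step 0 _ _ hZ0 hU0
    simpa [eulerProd] using this
  | succ N ih =>
    have := step (N + 1) _ _ ih.1 ih.2
    refine ⟨by simpa using this.1, ?_⟩
    convert! this.2 using 1
    rw [eulerProd_succ _ (N + 1), eulerProd_succ _ N]
    ring

lemma tendsto_eulerProd {q : ℂ} (hq : ‖q‖ < 1) :
    Tendsto (eulerProd q) atTop (𝓝 (∏' n : ℕ, (1 - q ^ (n + 1)))) :=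
  (ModularForm.multipliable_one_sub_pow hq).hasProd.tendsto_prod_nat

lemma tprod_one_sub_qexp_ne_zero {τ : ℂ} (hτ : 0 < τ.im) :
    ∏' n : ℕ, (1 - qexp τ ^ (n + 1)) ≠ 0 := by
  have := ModularForm.eta_tprod_ne_zero (z := τ) hτ
  simpa [ModularForm.eta_q_eq_pow, qexp] using this

/-- The series `∑_n (-1)^n n q^{n(n+1)/2} = ∏_{n ≥ 1} (1 - q^n)³` of Jacobi, as the limit of the
first moments of the finite triple products. -/
lemma hasSum_jacobi_cube {τ : ℂ} (hτ : 0 < τ.im) :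
    HasSum (fun n : ℤ => n * qexp (n / 2 + n * (n + 1) / 2 * τ))
      ((∏' n : ℕ, (1 - qexp τ ^ (n + 1))) ^ 3) := by
  have hq := norm_qexp_lt_one hτ
  set q := qexp τ with hqdef
  set P := ∏' n : ℕ, (1 - q ^ (n + 1)) with hP
  have hP0 : P ≠ 0 := tprod_one_sub_qexp_ne_zero hτ
  have hlim := tendsto_eulerProd hq
  have hinv : Tendsto (invEulerProd q) atTop (𝓝 P⁻¹) := by
    have h1 : Tendsto (fun n : ℕ => (eulerProd q n)⁻¹) atTop (𝓝 P⁻¹) := hlim.inv₀ hP0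
    refine (h1.comp (tendsto_atTop_atTop.2 fun b => ⟨b, fun a ha => ?_⟩ :
      Tendsto Int.toNat atTop atTop)).congr' ?_
    · omega
    · filter_upwards [eventually_ge_atTop 0] with k hk
      simp [invEulerProd, not_lt.2 hk]
  obtain ⟨B₁, hB₁⟩ := (hlim.norm.bddAbove_range)
  obtain ⟨B₂, hB₂⟩ := ((hlim.inv₀ hP0).norm.bddAbove_range)
  have hb1 : ∀ n, ‖eulerProd q n‖ ≤ B₁ := fun n => hB₁ ⟨n, rfl⟩
  have hB2 : 0 ≤ B₂ := (norm_nonneg _).trans (hB₂ ⟨0, rfl⟩)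
  have hb2 : ∀ k, ‖invEulerProd q k‖ ≤ B₂ := by
    intro k
    rw [invEulerProd]
    split_ifs
    · simpa using hB2
    · exact hB₂ ⟨_, rfl⟩
  have hsum : Summable fun n : ℤ => (n : ℂ) * qexp (n / 2 + n * (n + 1) / 2 * τ) := by
    have h := ((summable_jacobiTheta₂'_term_iff (1 / 2 + τ / 2) τ).2 hτ).mul_left
      (2 * Real.pi * I : ℂ)⁻¹
    refine h.congr fun n => ?_
    rw [jacobiTheta₂'_term, jacobiTheta₂_term, qexp]
    rw [show (2 * Real.pi * I : ℂ)⁻¹ * (2 * Real.pi * I * n *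
        cexp (2 * Real.pi * I * n * (1 / 2 + τ / 2) + Real.pi * I * n ^ 2 * τ)) =
        ((2 * Real.pi * I : ℂ)⁻¹ * (2 * Real.pi * I)) * (n *
        cexp (2 * Real.pi * I * n * (1 / 2 + τ / 2) + Real.pi * I * n ^ 2 * τ)) by ring,
      inv_mul_cancel₀ Complex.two_pi_I_ne_zero, one_mul]
    ring_nf
  have key : Tendsto (fun N : ℕ => ∑' n : ℤ, (n : ℂ) * finiteTripleCoeff τ (N + 1) n) atTop
      (𝓝 (∑' n : ℤ, (n : ℂ) * (qexp (n / 2 + n * (n + 1) / 2 * τ) * (P * P⁻¹ * P⁻¹)))) := by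
    refine tendsto_tsum_of_dominated_convergence
      (bound := fun n : ℤ => ‖(n : ℂ) * qexp (n / 2 + n * (n + 1) / 2 * τ)‖ * (B₁ * B₂ * B₂))
      (hsum.norm.mul_right _) ?_ ?_
    · intro n
      refine Tendsto.const_mul _ (Tendsto.const_mul _ ((Tendsto.mul ?_ ?_).mul ?_))
      · exact hlim.comp (tendsto_atTop_mono (fun N : ℕ => (by omega : N ≤ 2 * (N + 1))) tendsto_id)
      · refine hinv.comp (tendsto_atTop_add_const_right _ _ ?_)
        exact tendsto_natCast_atTop_atTop.comp (tendsto_add_atTop_nat 1)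
      · refine hinv.comp (tendsto_atTop_add_const_right _ _ ?_)
        exact tendsto_natCast_atTop_atTop.comp (tendsto_add_atTop_nat 1)
    · refine .of_forall fun N n => ?_
      have hB1 : 0 ≤ B₁ := (norm_nonneg _).trans (hb1 0)
      rw [finiteTripleCoeff, ← mul_assoc, norm_mul, norm_mul (_ * _) (invEulerProd _ _),
        norm_mul (eulerProd _ _)]
      gcongr
      exacts [hb1 _, hb2 _, hb2 _]
  simp only [(hasSum_finiteTripleCoeff hτ _).2.tsum_eq] at key
  have key2 := tendsto_nhds_unique key (hlim.mul (hlim.comp (tendsto_add_atTop_nat 1)))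
  simp only [← mul_assoc, tsum_mul_right] at key2
  convert! hsum.hasSum using 1
  generalize ∑' n : ℤ, (n : ℂ) * qexp (n / 2 + n * (n + 1) / 2 * τ) = S at key2 ⊢
  rw [← hP] at key2
  field_simp at key2
  rw [key2]

/-! ### The theta function `ϑ₁₁` and its derivative at the origin -/

lemma mumfordTheta_term (τ z : ℂ) (n : ℤ) :
    cexp (Real.pi * I * (n + ((1 : Fin 2) : ℕ) / 2) ^ 2 * τ +
      2 * Real.pi * I * (n + ((1 : Fin 2) : ℕ) / 2) * (z + ((1 : Fin 2) : ℕ) / 2)) =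
      qexp ((n + 1 / 2) ^ 2 / 2 * τ + (n + 1 / 2) * (z + 1 / 2)) := by
  rw [qexp]
  congr 1
  simp only [Fin.val_one, Nat.cast_one]
  ring

lemma mumfordTheta_eq_tsum (τ z : ℂ) : mumfordTheta 1 1 τ z =
    ∑' n : ℤ, qexp ((n + 1 / 2) ^ 2 / 2 * τ + (n + 1 / 2) * (z + 1 / 2)) :=
  tsum_congr fun n => mumfordTheta_term τ z n

lemma mumfordTheta_eq_jacobiTheta₂ (τ z : ℂ) : mumfordTheta 1 1 τ z =
    qexp (τ / 8 + (z + 1 / 2) / 2) * jacobiTheta₂ (z + (1 / 2 + τ / 2)) τ := by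
  rw [mumfordTheta_eq_tsum, jacobiTheta₂, ← tsum_mul_left]
  refine tsum_congr fun n => ?_
  rw [jacobiTheta₂_term, qexp, qexp, ← Complex.exp_add]
  congr 1
  ring

lemma differentiable_mumfordTheta {τ : ℂ} (hτ : 0 < τ.im) :
    Differentiable ℂ (mumfordTheta 1 1 τ) := by
  rw [funext (mumfordTheta_eq_jacobiTheta₂ τ)]
  refine Differentiable.mul (differentiable_qexp.comp (by fun_prop)) fun z => ?_
  exact (differentiableAt_jacobiTheta₂_fst _ hτ).comp z (by fun_prop)

lemma mumfordTheta_neg (τ z : ℂ) : mumfordTheta 1 1 τ (-z) = -mumfordTheta 1 1 τ z := by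
  rw [mumfordTheta_eq_tsum, mumfordTheta_eq_tsum, ← (Equiv.subLeft (-1 : ℤ)).tsum_eq, ← tsum_neg]
  refine tsum_congr fun n => ?_
  rw [neg_qexp]
  refine qexp_eq_of_eq_add_int (-n - 1) ?_
  simp only [Equiv.subLeft_apply]
  push_cast
  ring

lemma mumfordTheta_zero (τ : ℂ) : mumfordTheta 1 1 τ 0 = 0 := by
  have := mumfordTheta_neg τ 0
  rw [neg_zero] at this
  exact self_eq_neg.1 this

lemma mumfordTheta_add_one (τ z : ℂ) : mumfordTheta 1 1 τ (z + 1) = -mumfordTheta 1 1 τ z := by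
  rw [mumfordTheta_eq_tsum, mumfordTheta_eq_tsum, ← tsum_neg]
  refine tsum_congr fun n => ?_
  rw [neg_qexp]
  refine qexp_eq_of_eq_add_int n ?_
  ring

lemma mumfordTheta_add_int_mul (τ z : ℂ) (n : ℤ) : mumfordTheta 1 1 τ (z + n * τ) =
    qexp (n / 2 - n ^ 2 / 2 * τ - n * z) * mumfordTheta 1 1 τ z := by
  rw [mumfordTheta_eq_tsum, mumfordTheta_eq_tsum, ← (Equiv.subRight n).tsum_eq, ← tsum_mul_left]
  refine tsum_congr fun k => ?_
  rw [← qexp_add]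
  refine qexp_eq_of_eq_add_int (-n) ?_
  simp only [Equiv.subRight_apply]
  push_cast
  ring

lemma mumfordTheta_int_add_int_mul (τ : ℂ) (a b : ℤ) : mumfordTheta 1 1 τ (a + b * τ) = 0 := by
  have h : ∀ a : ℤ, mumfordTheta 1 1 τ a = 0 := by
    intro a
    induction a using Int.induction_on with
    | zero => simpa using mumfordTheta_zero τ
    | succ n ih =>
      have := mumfordTheta_add_one τ n
      push_cast at ih ⊢
      rw [this, ih, neg_zero]
    | pred n ih =>
      have := mumfordTheta_add_one τ (-n - 1)
      push_cast at ih ⊢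
      rw [sub_add_cancel, ih] at this
      exact neg_eq_zero.1 this.symm
  rw [mumfordTheta_add_int_mul, h, mul_zero]

lemma eta_pow_three (τ : ℂ) :
    ModularForm.eta τ ^ 3 = qexp (τ / 8) * (∏' n : ℕ, (1 - qexp τ ^ (n + 1))) ^ 3 := by
  rw [ModularForm.eta, mul_pow]
  congr 1
  · rw [Function.Periodic.qParam, ← Complex.exp_nat_mul, qexp]
    congr 1
    push_cast
    ring
  · simp_rw [ModularForm.eta_q_eq_pow, qexp]

lemma eta_pow_three_ne_zero {τ : ℂ} (hτ : 0 < τ.im) : ModularForm.eta τ ^ 3 ≠ 0 :=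
  pow_ne_zero _ (ModularForm.eta_ne_zero hτ)

/-- Jacobi's derivative formula `ϑ₁₁'(0) = -2π η³`. -/
lemma hasDerivAt_mumfordTheta_zero {τ : ℂ} (hτ : 0 < τ.im) :
    HasDerivAt (mumfordTheta 1 1 τ) (-(2 * Real.pi * ModularForm.eta τ ^ 3)) 0 := by
  have hJ0 : jacobiTheta₂ (0 + (1 / 2 + τ / 2)) τ = 0 := by
    have := mumfordTheta_eq_jacobiTheta₂ τ 0
    rw [mumfordTheta_zero] at this
    exact (mul_eq_zero.1 this.symm).resolve_left (qexp_ne_zero _)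
  have hJ1 : jacobiTheta₂' (0 + (1 / 2 + τ / 2)) τ =
      2 * Real.pi * I * (∏' n : ℕ, (1 - qexp τ ^ (n + 1))) ^ 3 := by
    rw [← ((hasSum_jacobi_cube hτ).mul_left _).tsum_eq, jacobiTheta₂']
    refine tsum_congr fun n => ?_
    rw [jacobiTheta₂'_term, jacobiTheta₂_term, qexp, mul_assoc]
    congr 3
    ring
  have h1 : HasDerivAt (fun z => jacobiTheta₂ (z + (1 / 2 + τ / 2)) τ)
      (jacobiTheta₂' (0 + (1 / 2 + τ / 2)) τ) 0 :=
    (hasDerivAt_jacobiTheta₂_fst _ hτ).comp_add_const 0 _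
  have h2 : DifferentiableAt ℂ (fun z => qexp (τ / 8 + (z + 1 / 2) / 2)) 0 :=
    (differentiable_qexp.comp (by fun_prop : Differentiable ℂ
      fun z : ℂ => τ / 8 + (z + 1 / 2) / 2)).differentiableAt
  have h3 := h2.hasDerivAt.mul h1
  rw [hJ0, mul_zero, zero_add, hJ1] at h3
  have h4 : mumfordTheta 1 1 τ = (fun z => qexp (τ / 8 + (z + 1 / 2) / 2)) *
      fun z => jacobiTheta₂ (z + (1 / 2 + τ / 2)) τ :=
    funext (mumfordTheta_eq_jacobiTheta₂ τ)
  rw [h4]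
  convert! h3 using 1
  have h5 : qexp (τ / 8 + (0 + 1 / 2) / 2) = qexp (τ / 8) * I := by
    rw [qexp_add]
    congr 1
    refine Eq.trans ?_ Complex.exp_pi_div_two_mul_I
    rw [qexp]
    congr 1
    ring
  rw [eta_pow_three, h5]
  linear_combination -(2 * Real.pi * qexp (τ / 8) * (∏' n : ℕ, (1 - qexp τ ^ (n + 1))) ^ 3) * I_sq

/-! ### The Appell sum of level one -/

/-- The `a`-th term of `appellSum`. -/
noncomputable def appellTerm (τ s t : ℂ) (a : ℤ) : ℂ :=
  qexp (a * (s + t) + a ^ 2 * τ) *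
    ((1 - qexp (s + a * τ))⁻¹ + (1 - qexp (t + a * τ))⁻¹ - 1)

/-- The Appell sum of level one in its symmetric form,
`∑_{a ∈ ℤ} e(a(s + t)) q^{a²} (1/(1 - e(s)q^a) + 1/(1 - e(t)q^a) - 1)`. -/
noncomputable def appellSum (τ s t : ℂ) : ℂ := ∑' a : ℤ, appellTerm τ s t a

lemma summable_qexp_one {τ : ℂ} (hτ : 0 < τ.im) (x : ℂ) :
    Summable fun a : ℤ => qexp (a * x + a ^ 2 * τ) := by
  simpa using summable_qexp hτ one_pos x

lemma Summable.mul_bounded {f g : ℤ → ℂ} {C : ℝ} (hf : Summable f) (hg : ∀ a, ‖g a‖ ≤ C) :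
    Summable fun a => f a * g a := by
  refine .of_norm_bounded (hf.norm.mul_right C) fun a => ?_
  rw [norm_mul]
  exact mul_le_mul_of_nonneg_left (hg a) (norm_nonneg _)

lemma summable_qexp_mul_inv {τ : ℂ} (hτ : 0 < τ.im) (x : ℂ) {s : ℂ} (hs : OffLattice τ s) :
    Summable fun a : ℤ => qexp (a * x + a ^ 2 * τ) * (1 - qexp (s + a * τ))⁻¹ := by
  obtain ⟨C, hC⟩ := hs.exists_bound hτ
  exact (summable_qexp_one hτ x).mul_bounded hC

lemma appellSum_comm (τ s t : ℂ) : appellSum τ s t = appellSum τ t s :=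
  tsum_congr fun a => by rw [appellTerm, appellTerm, add_comm s t, add_comm (_)⁻¹]

lemma appellSum_eq {τ : ℂ} (hτ : 0 < τ.im) {s t : ℂ} (hs : OffLattice τ s)
    (ht : OffLattice τ t) : appellSum τ s t =
      ∑' a : ℤ, qexp (a * (s + t) + a ^ 2 * τ) * (1 - qexp (s + a * τ))⁻¹
        + ∑' a : ℤ, qexp (a * (s + t) + a ^ 2 * τ) * (1 - qexp (t + a * τ))⁻¹
        - ∑' a : ℤ, qexp (a * (s + t) + a ^ 2 * τ) := by
  have h1 := summable_qexp_mul_inv hτ (s + t) hs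
  have h2 := summable_qexp_mul_inv hτ (s + t) ht
  rw [← h1.tsum_add h2, ← (h1.add h2).tsum_sub (summable_qexp_one hτ _)]
  refine tsum_congr fun a => ?_
  rw [appellTerm]
  ring

lemma appellSum_add_one (τ s t : ℂ) : appellSum τ (s + 1) (t - 1) = appellSum τ s t := by
  refine tsum_congr fun a => ?_
  rw [appellTerm, appellTerm, show s + 1 + (t - 1) = s + t by ring,
    qexp_eq_of_eq_add_int (x := s + 1 + a * τ) (y := s + a * τ) 1 (by push_cast; ring),
    qexp_eq_of_eq_add_int (x := t - 1 + a * τ) (y := t + a * τ) (-1) (by push_cast; ring)]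

/-- If `s + t` is a lattice point, the substitution `a ↦ -a - b` turns the second geometric
factor into one minus the first. -/
lemma appellSum_eq_zero {τ : ℂ} (hτ : 0 < τ.im) {s t : ℂ} (hs : OffLattice τ s)
    (ht : OffLattice τ t) {c b : ℤ} (hst : s + t = c + b * τ) : appellSum τ s t = 0 := by
  have h1 := summable_qexp_mul_inv hτ (s + t) hs
  have h0 := summable_qexp_one hτ (s + t)
  have key : ∑' a : ℤ, qexp (a * (s + t) + a ^ 2 * τ) * (1 - qexp (t + a * τ))⁻¹ =
      ∑' a : ℤ, (qexp (a * (s + t) + a ^ 2 * τ)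
        - qexp (a * (s + t) + a ^ 2 * τ) * (1 - qexp (s + a * τ))⁻¹) := by
    rw [← (Equiv.subLeft (-b : ℤ)).tsum_eq]
    refine tsum_congr fun a => ?_
    have e1 : qexp (((-b - a : ℤ) : ℂ) * (s + t) + ((-b - a : ℤ) : ℂ) ^ 2 * τ) =
        qexp (a * (s + t) + a ^ 2 * τ) := by
      refine qexp_eq_of_eq_add_int (-(b + 2 * a) * c) ?_
      rw [hst]
      push_cast
      ring
    have e2 : qexp (t + ((-b - a : ℤ) : ℂ) * τ) = (qexp (s + a * τ))⁻¹ := by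
      rw [← qexp_neg]
      refine qexp_eq_of_eq_add_int c ?_
      push_cast
      linear_combination hst
    rw [Equiv.subLeft_apply, e1, e2]
    have h3 := offLattice_iff.1 hs a
    have h4 := qexp_ne_zero (s + a * τ)
    generalize qexp (s + a * τ) = x at *
    have h5 : x - 1 ≠ 0 := fun h => h3 (by linear_combination -h)
    field_simp
    ring
  rw [appellSum_eq hτ hs ht, key, h0.tsum_sub h1]
  ring

lemma appellSum_add_period {τ : ℂ} (hτ : 0 < τ.im) {s t : ℂ} (hs : OffLattice τ s)
    (ht : OffLattice τ t) :
    appellSum τ (s + τ) (t - τ) = qexp (τ + s - t) * appellSum τ s t := by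
  have hs' : OffLattice τ (s + τ) := by simpa using hs.add_int_mul 1
  have ht' : OffLattice τ (t - τ) := by simpa using ht.sub_int_mul 1
  have h1 := summable_qexp_mul_inv hτ (s + t) hs
  have h2 := summable_qexp_mul_inv hτ (s + t) ht
  have h0 := summable_qexp_one hτ (s + t)
  -- After shifting `a`, the term with pole at `x = 1`, `x = e(s)q^a`, carries the factor `x⁻²`;
  -- from `x⁻² / (1 - x) = 1 / (1 - x) + x⁻¹ + x⁻²` it splits into the old term and two theta terms.
  have k1 : ∑' a : ℤ, qexp (a * (s + t) + a ^ 2 * τ) * (1 - qexp (s + τ + a * τ))⁻¹ =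
      ∑' a : ℤ, (qexp (τ + s - t) *
          (qexp (a * (s + t) + a ^ 2 * τ) * (1 - qexp (s + a * τ))⁻¹)
        + qexp ((a - 1) * (s + t) + (a - 1) ^ 2 * τ)
        + qexp (τ - t + a * (s + t) + a ^ 2 * τ - a * τ)) := by
    rw [← (Equiv.subRight (1 : ℤ)).tsum_eq]
    refine tsum_congr fun a => ?_
    rw [Equiv.subRight_apply]
    have e1 : qexp (s + τ + ((a - 1 : ℤ) : ℂ) * τ) = qexp (s + a * τ) := by
      congr 1; push_cast; ring
    have e2 : qexp (((a - 1 : ℤ) : ℂ) * (s + t) + ((a - 1 : ℤ) : ℂ) ^ 2 * τ) =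
        qexp ((a - 1) * (s + t) + (a - 1) ^ 2 * τ) := by
      congr 1; push_cast; ring
    have e3 : qexp (τ + s - t) * qexp (a * (s + t) + a ^ 2 * τ) =
        qexp ((a - 1) * (s + t) + (a - 1) ^ 2 * τ) * qexp (s + a * τ) * qexp (s + a * τ) := by
      simp only [← qexp_add]; congr 1; ring
    have e4 : qexp (τ - t + a * (s + t) + a ^ 2 * τ - a * τ) =
        qexp ((a - 1) * (s + t) + (a - 1) ^ 2 * τ) * qexp (s + a * τ) := by
      simp only [← qexp_add]; congr 1; ring
    rw [e1, e2, ← mul_assoc, e3, e4]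
    have h3 := offLattice_iff.1 hs a
    field_simp
    ring
  -- Likewise `y² / (1 - y) = 1 / (1 - y) - 1 - y` for `y = e(t)q^a`.
  have k2 : ∑' a : ℤ, qexp (a * (s + t) + a ^ 2 * τ) * (1 - qexp (t - τ + a * τ))⁻¹ =
      ∑' a : ℤ, (qexp (τ + s - t) *
          (qexp (a * (s + t) + a ^ 2 * τ) * (1 - qexp (t + a * τ))⁻¹)
        - qexp (τ + s - t) * qexp (a * (s + t) + a ^ 2 * τ)
        - qexp (τ + s + a * (s + t) + a ^ 2 * τ + a * τ)) := by
    rw [← (Equiv.addRight (1 : ℤ)).tsum_eq]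
    refine tsum_congr fun a => ?_
    rw [Equiv.coe_addRight]
    have e1 : qexp (t - τ + ((a + 1 : ℤ) : ℂ) * τ) = qexp (t + a * τ) := by
      congr 1; push_cast; ring
    have e2 : qexp (((a + 1 : ℤ) : ℂ) * (s + t) + ((a + 1 : ℤ) : ℂ) ^ 2 * τ) =
        qexp (τ + s - t) * qexp (a * (s + t) + a ^ 2 * τ) * qexp (t + a * τ) *
          qexp (t + a * τ) := by
      simp only [← qexp_add]; congr 1; push_cast; ring
    have e4 : qexp (τ + s + a * (s + t) + a ^ 2 * τ + a * τ) =
        qexp (τ + s - t) * qexp (a * (s + t) + a ^ 2 * τ) * qexp (t + a * τ) := by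
      simp only [← qexp_add]; congr 1; ring
    rw [e1, e2, e4]
    have h3 := offLattice_iff.1 ht a
    generalize qexp (t + a * τ) = y at *
    field_simp
    ring
  have g1 : Summable fun a : ℤ => qexp ((a - 1 : ℂ) * (s + t) + (a - 1) ^ 2 * τ) := by
    refine ((Equiv.subRight (1 : ℤ)).summable_iff.2 h0).congr fun a => ?_
    simp
  have g1' : ∑' a : ℤ, qexp ((a - 1 : ℂ) * (s + t) + (a - 1) ^ 2 * τ) =
      ∑' a : ℤ, qexp (a * (s + t) + a ^ 2 * τ) := by
    rw [← (Equiv.subRight (1 : ℤ)).tsum_eq (fun a : ℤ => qexp (a * (s + t) + a ^ 2 * τ))]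
    simp
  have g2 : Summable fun a : ℤ => qexp (τ + s + a * (s + t) + a ^ 2 * τ + a * τ) := by
    refine ((summable_qexp_one hτ (s + t + τ)).mul_left (qexp (τ + s))).congr fun a => ?_
    rw [← qexp_add]; congr 1; ring
  have g3 : (fun a : ℤ => qexp (τ - t + a * (s + t) + a ^ 2 * τ - a * τ)) =
      (fun a : ℤ => qexp (τ + s + a * (s + t) + a ^ 2 * τ + a * τ)) ∘ (Equiv.subRight (1 : ℤ)) := by
    ext a
    simp only [Function.comp, Equiv.subRight_apply]
    congr 1; push_cast; ring
  have g4 : Summable fun a : ℤ => qexp (τ - t + a * (s + t) + a ^ 2 * τ - a * τ) := by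
    rw [g3]; exact (Equiv.subRight (1 : ℤ)).summable_iff.2 g2
  have g5 : ∑' a : ℤ, qexp (τ - t + a * (s + t) + a ^ 2 * τ - a * τ) =
      ∑' a : ℤ, qexp (τ + s + a * (s + t) + a ^ 2 * τ + a * τ) := by
    rw [g3]
    exact (Equiv.subRight (1 : ℤ)).tsum_eq
      fun a : ℤ => qexp (τ + s + a * (s + t) + a ^ 2 * τ + a * τ)
  rw [appellSum_eq hτ hs' ht', appellSum_eq hτ hs ht, show s + τ + (t - τ) = s + t by ring, k1, k2,
    ((h1.mul_left _).add g1).tsum_add g4, (h1.mul_left _).tsum_add g1,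
    ((h2.mul_left _).sub (h0.mul_left _)).tsum_sub g2, (h2.mul_left _).tsum_sub (h0.mul_left _),
    g1', g5, tsum_mul_left, tsum_mul_left, tsum_mul_left]
  ring

lemma differentiableAt_appellSum {τ : ℂ} (hτ : 0 < τ.im) {u s : ℂ} (hs : OffLattice τ s)
    (hu : OffLattice τ (u - s)) : DifferentiableAt ℂ (fun s => appellSum τ s (u - s)) s := by
  obtain ⟨C₁, hC₁⟩ := exists_bound_inv_one_sub_qexp hτ s
  obtain ⟨C₂, hC₂⟩ := exists_bound_inv_one_sub_qexp hτ (u - s)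
  have hc : Tendsto (fun s' => u - s') (𝓝 s) (𝓝 (u - s)) :=
    (continuous_const.sub continuous_id).continuousAt
  have hev := ((hC₁.and (hc.eventually hC₂)).and
    ((hs.eventually hτ).and (hc.eventually (hu.eventually hτ))))
  obtain ⟨U, hU, hUo, hsU⟩ := eventually_nhds_iff.1 hev
  have h0 := (summable_qexp_one hτ u).norm.mul_right (C₁ + C₂ + 1)
  refine (differentiableOn_tsum_of_summable_norm h0 (fun a x hx => ?_) hUo
    fun a x hx => ?_).differentiableAt (hUo.mem_nhds hsU)
  · obtain ⟨-, h1, h2⟩ := hU x hx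
    unfold appellTerm
    have d : ∀ f : ℂ → ℂ, Differentiable ℂ f → Differentiable ℂ fun y => qexp (f y) :=
      fun f hf => differentiable_qexp.comp hf
    refine DifferentiableAt.differentiableWithinAt (DifferentiableAt.mul ?_
      ((DifferentiableAt.add ?_ ?_).sub_const 1))
    · exact (d _ (by fun_prop)) x
    · exact ((d _ (by fun_prop)) x).const_sub 1 |>.inv (offLattice_iff.1 h1 a)
    · exact ((d _ (by fun_prop)) x).const_sub 1 |>.inv (offLattice_iff.1 h2 a)
  · obtain ⟨⟨h1, h2⟩, -⟩ := hU x hx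
    have h1' := h1 a (offLattice_iff.1 hs a)
    have h2' := h2 a (offLattice_iff.1 hu a)
    rw [appellTerm, norm_mul, show x + (u - x) = u by ring]
    gcongr
    refine (norm_sub_le _ _).trans ?_
    rw [norm_one]
    gcongr
    exact (norm_add_le _ _).trans (add_le_add h1' h2')

/-- Only the term `a = 0` of the Appell sum has a pole at `s = 0`. -/
lemma tendsto_one_sub_mul_appellSum {τ : ℂ} (hτ : 0 < τ.im) {u : ℂ} (hu : OffLattice τ u) :
    Tendsto (fun s => (1 - qexp s) * appellSum τ s (u - s)) (𝓝[≠] 0) (𝓝 1) := by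
  obtain ⟨C₁, hC₁⟩ := exists_bound_inv_one_sub_qexp hτ 0
  obtain ⟨C₂, hC₂⟩ := exists_bound_inv_one_sub_qexp hτ u
  have hc : Tendsto (fun s' => u - s') (𝓝 0) (𝓝 u) := by
    have : Continuous fun s' => u - s' := by fun_prop
    simpa using this.tendsto 0
  have hz : Tendsto (fun s => 1 - qexp s) (𝓝 0) (𝓝 0) := by
    simpa [qexp_zero] using (differentiable_qexp.continuous.tendsto 0).const_sub 1
  have hne : ∀ a : ℤ, a ≠ 0 → 1 - qexp (0 + a * τ) ≠ 0 := by
    intro a ha h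
    obtain ⟨n, hn⟩ := qexp_eq_one_iff.1 (sub_eq_zero.1 h).symm
    have := congrArg Complex.im hn
    simp at this
    exact this.elim ha hτ.ne'
  have hsmall : ∀ᶠ s in 𝓝 (0 : ℂ), ‖1 - qexp s‖ < 1 := by
    simpa using hz.norm.eventually (gt_mem_nhds (by norm_num : ‖(0 : ℂ)‖ < 1))
  have hcont : ∀ (z : ℂ) (a : ℤ), 1 - qexp (z + a * τ) ≠ 0 →
      ContinuousAt (fun s => (1 - qexp (s + a * τ))⁻¹) z := fun z a h =>
    (continuousAt_const.sub
      (differentiable_qexp.continuous.continuousAt.comp (by fun_prop))).inv₀ h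
  have hlim : Tendsto (fun s => ∑' a : ℤ, (1 - qexp s) * appellTerm τ s (u - s) a) (𝓝[≠] 0)
      (𝓝 (∑' a : ℤ, qexp (a * u + a ^ 2 * τ) * if a = 0 then 1 else 0)) := by
    refine tendsto_tsum_of_dominated_convergence
      (bound := fun a : ℤ => ‖qexp (a * u + a ^ 2 * τ)‖ * (1 + |C₁| + C₂ + 1))
      ((summable_qexp_one hτ u).norm.mul_right _) ?_ ?_
    · intro a
      have heq : ∀ s : ℂ, (1 - qexp s) * appellTerm τ s (u - s) a =
          qexp (a * u + a ^ 2 * τ) * ((1 - qexp s) * (1 - qexp (s + a * τ))⁻¹ +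
            (1 - qexp s) * ((1 - qexp (u - s + a * τ))⁻¹ - 1)) := by
        intro s
        rw [appellTerm, show s + (u - s) = u by ring]
        ring
      simp only [heq]
      refine Tendsto.const_mul _ ?_
      have t2 : Tendsto (fun s => (1 - qexp s) * ((1 - qexp (u - s + a * τ))⁻¹ - 1)) (𝓝[≠] 0)
          (𝓝 0) := by
        have := hz.mul (((hcont u a (offLattice_iff.1 hu a)).tendsto.comp hc).sub_const 1)
        rw [zero_mul] at this
        exact this.mono_left nhdsWithin_le_nhds
      have t1 : Tendsto (fun s => (1 - qexp s) * (1 - qexp (s + a * τ))⁻¹) (𝓝[≠] 0)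
          (𝓝 (if a = 0 then 1 else 0)) := by
        split_ifs with ha
        · refine tendsto_const_nhds.congr' ?_
          filter_upwards [eventually_offLattice hτ 0] with s hs
          have := offLattice_iff.1 hs 0
          simp only [Int.cast_zero, zero_mul, add_zero] at this
          rw [ha, Int.cast_zero, zero_mul, add_zero, mul_inv_cancel₀ this]
        · have := hz.mul (hcont 0 a (hne a ha)).tendsto
          rw [zero_mul] at this
          exact this.mono_left nhdsWithin_le_nhds
      simpa using t1.add t2
    · filter_upwards [nhdsWithin_le_nhds hC₁, nhdsWithin_le_nhds (hc.eventually hC₂),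
        nhdsWithin_le_nhds hsmall] with s h1 h2 h3 a
      have b1 : ‖(1 - qexp s) * (1 - qexp (s + a * τ))⁻¹‖ ≤ 1 + |C₁| := by
        rcases eq_or_ne a 0 with rfl | ha
        · simp only [Int.cast_zero, zero_mul, add_zero]
          refine le_trans ?_ (le_add_of_nonneg_right (abs_nonneg _))
          rw [norm_mul, norm_inv]
          exact mul_inv_le_one
        · rw [norm_mul]
          calc _ ≤ 1 * |C₁| :=
                mul_le_mul h3.le ((h1 a (hne a ha)).trans (le_abs_self _)) (norm_nonneg _)
                  one_pos.le
            _ ≤ _ := by linarith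
      have b2 : ‖(1 - qexp s) * (1 - qexp (u - s + a * τ))⁻¹‖ ≤ C₂ := by
        rw [norm_mul]
        have := h2 a (offLattice_iff.1 hu a)
        calc _ ≤ 1 * C₂ := mul_le_mul h3.le this (norm_nonneg _) one_pos.le
          _ = _ := one_mul _
      rw [appellTerm, show s + (u - s) = u by ring,
        show (1 - qexp s) * (qexp (a * u + a ^ 2 * τ) *
          ((1 - qexp (s + a * τ))⁻¹ + (1 - qexp (u - s + a * τ))⁻¹ - 1)) =
          qexp (a * u + a ^ 2 * τ) * ((1 - qexp s) * (1 - qexp (s + a * τ))⁻¹ +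
            (1 - qexp s) * (1 - qexp (u - s + a * τ))⁻¹ - (1 - qexp s)) by ring, norm_mul]
      gcongr
      refine (norm_sub_le _ _).trans (add_le_add ((norm_add_le _ _).trans (add_le_add b1 b2)) h3.le)
  have hval : ∑' a : ℤ, qexp (a * u + a ^ 2 * τ) * (if a = 0 then 1 else 0) = 1 := by
    rw [tsum_eq_single 0 (fun a ha => by simp [ha])]
    simp [qexp_zero]
  rw [hval] at hlim
  simpa only [tsum_mul_left, appellSum] using hlim

/-! ### The denominator identity -/

/-- A continuous doubly periodic function that is holomorphic off a countable set is constant. -/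
lemma eq_of_doubly_periodic {τ : ℂ} (hτ : 0 < τ.im) {f : ℂ → ℂ} {S : Set ℂ} (hS : S.Countable)
    (hc : Continuous f) (hd : ∀ z ∉ S, DifferentiableAt ℂ f z) (h1 : Function.Periodic f 1)
    (h2 : Function.Periodic f τ) (z w : ℂ) : f z = f w := by
  have hdiff : Differentiable ℂ f := fun z =>
    (hasFPowerSeriesOnBall_of_differentiable_off_countable (R := 1) hS hc.continuousOn
      (fun x hx => hd x hx.2) one_pos).differentiableOn.differentiableAt
        (Metric.eball_mem_nhds z (by simp))
  refine hdiff.apply_eq_apply_of_bounded ?_ z w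
  have hK : IsCompact ((fun p : ℝ × ℝ => f (p.1 + p.2 * τ)) ''
      (Set.Icc (0 : ℝ) 1 ×ˢ Set.Icc (0 : ℝ) 1)) :=
    (isCompact_Icc.prod isCompact_Icc).image (by fun_prop)
  refine hK.isBounded.subset ?_
  rintro _ ⟨s, rfl⟩
  -- The real coordinates of `s` in the basis `1, τ`.
  set y : ℝ := s.im / τ.im with hy
  set x : ℝ := s.re - y * τ.re with hx
  have hs : s = x + y * τ := by
    apply Complex.ext
    · simp [hx]
    · simp [hy, hτ.ne']
  refine ⟨(Int.fract x, Int.fract y), ⟨⟨Int.fract_nonneg _, (Int.fract_lt_one _).le⟩,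
    ⟨Int.fract_nonneg _, (Int.fract_lt_one _).le⟩⟩, ?_⟩
  have e : s = ((Int.fract x : ℝ) : ℂ) + ((Int.fract y : ℝ) : ℂ) * τ + ⌊x⌋ * 1 + ⌊y⌋ * τ := by
    rw [hs]
    have hx' : (x : ℂ) = ⌊x⌋ + (Int.fract x : ℝ) := by
      exact_mod_cast (Int.floor_add_fract x).symm
    have hy' : (y : ℂ) = ⌊y⌋ + (Int.fract y : ℝ) := by
      exact_mod_cast (Int.floor_add_fract y).symm
    linear_combination hx' + τ * hy'
  change f (_ + _) = f s
  rw [e, h2.int_mul, h1.int_mul]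

lemma countable_not_offLattice (τ : ℂ) : {s | ¬ OffLattice τ s}.Countable := by
  refine (Set.countable_range fun p : ℤ × ℤ => (p.1 + p.2 * τ : ℂ)).mono ?_
  intro s hs
  simp only [OffLattice, Set.mem_ofPred_eq, not_forall, not_not] at hs
  obtain ⟨a, b, h⟩ := hs
  exact ⟨(a, b), h.symm⟩

lemma offLattice_add_one_iff {τ z : ℂ} : OffLattice τ (z + 1) ↔ OffLattice τ z :=
  ⟨fun h => by simpa using h.sub_one, fun h => h.add_one⟩

lemma offLattice_add_period_iff {τ z : ℂ} : OffLattice τ (z + τ) ↔ OffLattice τ z :=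
  ⟨fun h => by simpa using h.sub_int_mul 1, fun h => by simpa using h.add_int_mul 1⟩

lemma not_offLattice_iff {τ z : ℂ} : ¬ OffLattice τ z ↔ ∃ a b : ℤ, z = a + b * τ := by
  simp [OffLattice]

open Classical in
/-- The denominator identity `f(s, t) ϑ₁₁(s) ϑ₁₁(t) = -i η³ ϑ₁₁(s + t)` for the Appell sum `f` of
level one. For a fixed sum `u = s + t` the left-hand side is an elliptic function of `s` whose
singularities, at the zeros of the theta factors, are removable; the constant is its value at
`s = 0`. -/
theorem appellSum_mul_mumfordTheta {τ : ℂ} (hτ : 0 < τ.im) {s t : ℂ} (hs : OffLattice τ s)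
    (ht : OffLattice τ t) :
    appellSum τ s t * mumfordTheta 1 1 τ s * mumfordTheta 1 1 τ t =
      -(I * ModularForm.eta τ ^ 3 * mumfordTheta 1 1 τ (s + t)) := by
  by_cases hu : OffLattice τ (s + t)
  swap
  · obtain ⟨a, b, h⟩ := not_offLattice_iff.1 hu
    rw [appellSum_eq_zero hτ hs ht h, h, mumfordTheta_int_add_int_mul]
    ring
  obtain ⟨u, hsu⟩ : ∃ u, u = s + t := ⟨_, rfl⟩
  rw [← hsu] at hu ⊢
  set K : ℂ := -(I * ModularForm.eta τ ^ 3 * mumfordTheta 1 1 τ u) with hK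
  set g : ℂ → ℂ := fun s =>
    appellSum τ s (u - s) * mumfordTheta 1 1 τ s * mumfordTheta 1 1 τ (u - s) with hg
  set G : ℂ → ℂ := fun s => if OffLattice τ s ∧ OffLattice τ (u - s) then g s else K with hG
  have hGg : ∀ s, OffLattice τ s → OffLattice τ (u - s) → G s = g s := fun s h1 h2 =>
    if_pos ⟨h1, h2⟩
  have hθ := differentiable_mumfordTheta hτ
  have hsubc : ∀ s, Tendsto (fun s' => u - s') (𝓝 s) (𝓝 (u - s)) := fun s =>
    (show Continuous fun s' => u - s' by fun_prop).tendsto s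
  have hsymm : ∀ s, G (u - s) = G s := by
    intro s
    have : g (u - s) = g s := by
      simp only [hg, sub_sub_cancel]
      rw [appellSum_comm]
      ring
    simp only [hG, sub_sub_cancel, this, and_comm]
  have hdiff : ∀ s, OffLattice τ s → OffLattice τ (u - s) → DifferentiableAt ℂ G s := by
    intro s h1 h2
    have hd : DifferentiableAt ℂ g s := by
      refine ((differentiableAt_appellSum hτ h1 h2).mul (hθ s)).mul ?_
      exact (hθ (u - s)).comp s (by fun_prop)
    refine hd.congr_of_eventuallyEq ?_
    filter_upwards [h1.eventually hτ, (hsubc s).eventually (h2.eventually hτ)] with x hx1 hx2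
    exact hGg x hx1 hx2
  have hper1 : Function.Periodic G 1 := by
    intro s
    have e1 : OffLattice τ (u - (s + 1)) ↔ OffLattice τ (u - s) := by
      rw [← offLattice_add_one_iff, show u - (s + 1) + 1 = u - s by ring]
    have e2 : g (s + 1) = g s := by
      have h := mumfordTheta_add_one τ (u - (s + 1))
      rw [show u - (s + 1) + 1 = u - s by ring] at h
      simp only [hg]
      rw [mumfordTheta_add_one, h, show u - (s + 1) = u - s - 1 by ring, appellSum_add_one]
      ring
    simp only [hG, e1, e2, offLattice_add_one_iff]
  have hper2 : Function.Periodic G τ := by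
    intro s
    have e1 : OffLattice τ (u - (s + τ)) ↔ OffLattice τ (u - s) := by
      rw [← offLattice_add_period_iff, show u - (s + τ) + τ = u - s by ring]
    by_cases h : OffLattice τ s ∧ OffLattice τ (u - s)
    · have e2 : g (s + τ) = g s := by
        have h3 := mumfordTheta_add_int_mul τ s 1
        have h4 := mumfordTheta_add_int_mul τ (u - s) (-1)
        have h5 := appellSum_add_period hτ h.1 h.2
        have h6 : qexp (τ + s - (u - s)) * qexp (((1 : ℤ) : ℂ) / 2 - ((1 : ℤ) : ℂ) ^ 2 / 2 * τ
            - ((1 : ℤ) : ℂ) * s) * qexp (((-1 : ℤ) : ℂ) / 2 - ((-1 : ℤ) : ℂ) ^ 2 / 2 * τ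
            - ((-1 : ℤ) : ℂ) * (u - s)) = 1 := by
          rw [← qexp_add, ← qexp_add, ← qexp_zero]
          congr 1
          push_cast
          ring
        rw [show s + ((1 : ℤ) : ℂ) * τ = s + τ by push_cast; ring] at h3
        rw [show u - s + ((-1 : ℤ) : ℂ) * τ = u - s - τ by push_cast; ring] at h4
        simp only [hg]
        rw [show u - (s + τ) = u - s - τ by ring, h3, h4, h5]
        linear_combination (appellSum τ s (u - s) * mumfordTheta 1 1 τ s *
          mumfordTheta 1 1 τ (u - s)) * h6
      simp only [hG, e1, e2, offLattice_add_period_iff]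
    · simp only [hG, e1, offLattice_add_period_iff, if_neg h]
  have hper : ∀ (a b : ℤ) (s : ℂ), G (s + (a + b * τ)) = G s := by
    intro a b s
    rw [← add_assoc, hper2.int_mul, ← mul_one (a : ℂ), hper1.int_mul]
  have hcont0 : ContinuousAt G 0 := by
    have hG0 : G 0 = K := if_neg fun h => h.1 0 0 (by simp)
    rw [continuousAt_iff_punctured_nhds, hG0]
    have l1 := tendsto_one_sub_mul_appellSum hτ hu
    have l2 : Tendsto (fun s => mumfordTheta 1 1 τ s / (1 - qexp s)) (𝓝[≠] 0)
        (𝓝 (-(I * ModularForm.eta τ ^ 3))) := by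
      have d1 := (hasDerivAt_mumfordTheta_zero hτ).tendsto_slope
      have d2 := ((hasDerivAt_qexp 0).const_sub 1).tendsto_slope
      have d3 := d1.div d2 (by simp [qexp_zero])
      have hv : -(2 * Real.pi * ModularForm.eta τ ^ 3) / -(2 * Real.pi * I * qexp 0) =
          -(I * ModularForm.eta τ ^ 3) := by
        have hpi' : (Real.pi : ℂ) ≠ 0 := by exact_mod_cast Real.pi_ne_zero
        rw [qexp_zero]
        field_simp
        rw [I_sq]
        ring
      rw [hv] at d3
      refine d3.congr' ?_
      filter_upwards [self_mem_nhdsWithin] with s hs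
      have hs0 : s ≠ 0 := hs
      simp only [Pi.div_apply, slope_def_field, mumfordTheta_zero, qexp_zero, sub_zero, sub_self]
      rw [div_div_div_cancel_right₀ hs0]
    have l3 : Tendsto (fun s => mumfordTheta 1 1 τ (u - s)) (𝓝[≠] 0)
        (𝓝 (mumfordTheta 1 1 τ u)) := by
      have := (hθ.continuous.comp (show Continuous fun s => u - s by fun_prop)).tendsto 0
      rw [Function.comp_apply, sub_zero] at this
      exact this.mono_left nhdsWithin_le_nhds
    have l4 := (l1.mul l2).mul l3
    rw [one_mul, neg_mul] at l4
    refine l4.congr' ?_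
    have hu0 : ∀ᶠ s in 𝓝 0, OffLattice τ (u - s) := by
      have := (hsubc 0).eventually ((sub_zero u).symm ▸ hu.eventually hτ)
      exact this
    filter_upwards [eventually_offLattice hτ 0, nhdsWithin_le_nhds hu0] with s h1 h2
    rw [hGg s h1 h2]
    have h3 := offLattice_iff.1 h1 0
    simp only [Int.cast_zero, zero_mul, add_zero] at h3
    simp only [hg]
    field_simp
  have hcontL : ∀ s, ¬ OffLattice τ s → ContinuousAt G s := by
    intro s hs
    obtain ⟨a, b, h⟩ := not_offLattice_iff.1 hs
    have hG' : G = fun x => G (x - s) := by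
      ext x
      rw [← hper a b (x - s), ← h, sub_add_cancel]
    rw [hG']
    have h0 : ContinuousAt G (s - s) := by rwa [sub_self]
    exact h0.comp (f := fun x => x - s) (by fun_prop)
  have hcont : Continuous G := by
    rw [continuous_iff_continuousAt]
    intro s
    by_cases h1 : OffLattice τ s
    swap
    · exact hcontL s h1
    by_cases h2 : OffLattice τ (u - s)
    · exact (hdiff s h1 h2).continuousAt
    · have hG' : G = fun x => G (u - x) := funext fun x => (hsymm x).symm
      rw [hG']
      exact (hcontL _ h2).comp (f := fun x => u - x) (by fun_prop)
  have hcount : ({s | ¬ OffLattice τ s} ∪ (fun s => u - s) ⁻¹' {s | ¬ OffLattice τ s}).Countable :=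
    (countable_not_offLattice τ).union
      ((countable_not_offLattice τ).preimage sub_right_injective)
  have hfin := eq_of_doubly_periodic hτ hcount hcont (fun z hz => by
    simp only [Set.mem_union, Set.mem_ofPred_eq, Set.mem_preimage, not_or, not_not] at hz
    exact hdiff z hz.1 hz.2) hper1 hper2 s 0
  have hut : u - s = t := by rw [hsu]; ring
  rw [hGg s hs (by rwa [hut]), show G 0 = K from if_neg fun h => h.1 0 0 (by simp)] at hfin
  simpa only [hg, hut] using hfin

/-- If `ϑ₁₁` vanished at a point outside the lattice, the denominator identity would make it vanish
near the origin, where its derivative is nonzero. -/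
lemma mumfordTheta_ne_zero {τ : ℂ} (hτ : 0 < τ.im) {z : ℂ} (hz : OffLattice τ z) :
    mumfordTheta 1 1 τ z ≠ 0 := by
  intro h0
  have hη := eta_pow_three_ne_zero hτ
  have hev : ∀ᶠ u in 𝓝 (0 : ℂ), mumfordTheta 1 1 τ u = 0 := by
    have hc : Tendsto (fun u : ℂ => u - z) (𝓝 0) (𝓝 (-z)) := by
      have : Continuous fun u : ℂ => u - z := by fun_prop
      simpa using this.tendsto 0
    filter_upwards [hc.eventually (hz.neg.eventually hτ)] with u hu
    have := appellSum_mul_mumfordTheta hτ hz hu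
    rw [h0, mul_zero, zero_mul, add_sub_cancel, eq_comm, neg_eq_zero] at this
    exact (mul_eq_zero.1 this).resolve_left (mul_ne_zero I_ne_zero hη)
  have h1 : HasDerivAt (mumfordTheta 1 1 τ) 0 0 :=
    (hasDerivAt_const (0 : ℂ) (0 : ℂ)).congr_of_eventuallyEq hev
  have h2 := h1.unique (hasDerivAt_mumfordTheta_zero hτ)
  have hpi' : (Real.pi : ℂ) ≠ 0 := by exact_mod_cast Real.pi_ne_zero
  exact neg_ne_zero.2 (mul_ne_zero (mul_ne_zero two_ne_zero hpi') hη) h2.symm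

/-! ### Appell sums of level `m` -/

/-- The Appell sum `∑_{j ∈ ℤ} e(mjw) q^{mj²} / (1 - e(z) q^j)`. -/
noncomputable def appellLerch (m : ℝ) (τ w z : ℂ) : ℂ :=
  ∑' j : ℤ, qexp (j * (m * w) + m * j ^ 2 * τ) * (1 - qexp (z + j * τ))⁻¹

/-- At `s = 0`, `t = 0` one has `Φ₂(a, b) = Φ₁(-b, -a)`. -/
lemma mockPhi_eq (m : ℝ) (τ a b : ℂ) : mockPhi m 0 τ a b 0 =
    appellLerch m τ (a + b) a - appellLerch m τ (-(a + b)) (-b) := by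
  rw [mockPhi, mockPhi₁, mockPhi₂, mul_zero, Complex.exp_zero, one_mul, one_mul, appellLerch,
    appellLerch]
  congr 1
  · refine tsum_congr fun j => ?_
    rw [div_eq_mul_inv, qpow_eq, qpow_eq]
    congr 1
    · rw [qexp, qexp, ← Complex.exp_add]
      congr 1
      push_cast
      ring
    · rw [qexp_add]
      simp only [qexp, Complex.ofReal_intCast]
  · refine tsum_congr fun j => ?_
    rw [div_eq_mul_inv, qpow_eq, qpow_eq]
    congr 1
    · rw [qexp, qexp, ← Complex.exp_add]
      congr 1
      push_cast
      ring
    · rw [qexp_add]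
      simp only [qexp, Complex.ofReal_intCast]
      ring_nf

lemma summable_appellLerch {m : ℝ} (hm : 0 < m) {τ : ℂ} (hτ : 0 < τ.im) (w : ℂ) {z : ℂ}
    (hz : OffLattice τ z) :
    Summable fun j : ℤ => qexp (j * (m * w) + m * j ^ 2 * τ) * (1 - qexp (z + j * τ))⁻¹ := by
  obtain ⟨C, hC⟩ := hz.exists_bound hτ
  exact (summable_qexp hτ hm _).mul_bounded hC

lemma appellLerch_neg_neg {m : ℝ} (hm : 0 < m) {τ : ℂ} (hτ : 0 < τ.im) (w : ℂ) {z : ℂ}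
    (hz : OffLattice τ z) :
    appellLerch m τ (-w) (-z) = thetaSeries m τ (m * w) - appellLerch m τ w z := by
  rw [appellLerch, thetaSeries, appellLerch,
    ← (summable_qexp hτ hm _).tsum_sub (summable_appellLerch hm hτ w hz),
    ← (Equiv.neg ℤ).tsum_eq]
  refine tsum_congr fun j => ?_
  have e1 : qexp (-z + ((-j : ℤ) : ℂ) * τ) = (qexp (z + j * τ))⁻¹ := by
    rw [← qexp_neg]; congr 1; push_cast; ring
  have e2 : qexp (((-j : ℤ) : ℂ) * (m * -w) + m * ((-j : ℤ) : ℂ) ^ 2 * τ) =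
      qexp (j * (m * w) + m * j ^ 2 * τ) := by
    congr 1; push_cast; ring
  rw [Equiv.neg_apply, e1, e2]
  have h3 := offLattice_iff.1 hz j
  have h4 := qexp_ne_zero (z + j * τ)
  generalize qexp (z + j * τ) = x at *
  have h5 : x - 1 ≠ 0 := fun h => h3 (by linear_combination -h)
  field_simp
  ring

/-- The general term of the double series
`∑_{a, n ∈ ℤ} e(au + mnw) q^{a² + mn²} / (1 - e(z) q^{a + n})`. -/
noncomputable def doubleAppellTerm (m : ℝ) (τ u w z : ℂ) (p : ℤ × ℤ) : ℂ :=
  qexp (p.1 * u + p.1 ^ 2 * τ) * qexp (p.2 * (m * w) + m * p.2 ^ 2 * τ) *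
    (1 - qexp (z + (p.1 + p.2) * τ))⁻¹

/-- The double series `∑_{a, n ∈ ℤ} e(au + mnw) q^{a² + mn²} / (1 - e(z) q^{a + n})`. -/
noncomputable def doubleAppell (m : ℝ) (τ u w z : ℂ) : ℂ := ∑' p, doubleAppellTerm m τ u w z p

lemma summable_doubleAppellTerm {m : ℝ} (hm : 0 < m) {τ : ℂ} (hτ : 0 < τ.im) (u w : ℂ) {z : ℂ}
    (hz : OffLattice τ z) : Summable (doubleAppellTerm m τ u w z) := by
  obtain ⟨C, hC⟩ := hz.exists_bound hτ
  have h := summable_mul_of_summable_norm (summable_qexp_one hτ u).norm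
    (summable_qexp hτ hm (m * w)).norm
  refine .of_norm_bounded (h.norm.mul_right C) fun p => ?_
  rw [doubleAppellTerm, norm_mul]
  refine mul_le_mul_of_nonneg_left ?_ (norm_nonneg _)
  simpa using hC (p.1 + p.2)

/-- Summing over `a` first turns two double series into Appell sums of level one at the points
`(z + nτ, z' - nτ)`, which are products of theta functions. -/
lemma doubleAppell_add {m : ℝ} (hm : 0 < m) {τ : ℂ} (hτ : 0 < τ.im) (w : ℂ) {u z z' : ℂ}
    (hz : OffLattice τ z) (hz' : OffLattice τ z') (hu : z + z' = u) :
    doubleAppell m τ u w z + doubleAppell m τ u (-w) z' =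
      thetaSeries m τ (m * w) * (∑' a : ℤ, qexp (a * u + a ^ 2 * τ)) -
        I * thetaSeries (m + 1) τ (z - z' + m * w) * (ModularForm.eta τ ^ 3 * mumfordTheta 1 1 τ u /
          (mumfordTheta 1 1 τ z * mumfordTheta 1 1 τ z')) := by
  have hs := summable_doubleAppellTerm hm hτ u w hz
  have hs' := summable_doubleAppellTerm hm hτ u (-w) hz'
  have h1 := (Equiv.prodComm ℤ ℤ).summable_iff.2 hs
  have h2 := (Equiv.prodComm ℤ ℤ).summable_iff.2 hs'
  set S := ∑' a : ℤ, qexp (a * u + a ^ 2 * τ) with hS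
  set κ := ModularForm.eta τ ^ 3 * mumfordTheta 1 1 τ u /
          (mumfordTheta 1 1 τ z * mumfordTheta 1 1 τ z') with hκ
  have i1 : doubleAppell m τ u w z =
      ∑' n : ℤ, ∑' a : ℤ, doubleAppellTerm m τ u w z (a, n) := by
    rw [doubleAppell, ← (Equiv.prodComm ℤ ℤ).tsum_eq]
    exact h1.tsum_prod
  have i2 : doubleAppell m τ u (-w) z' =
      ∑' n : ℤ, ∑' a : ℤ, doubleAppellTerm m τ u (-w) z' (a, -n) := by
    rw [doubleAppell, ← (Equiv.prodComm ℤ ℤ).tsum_eq]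
    exact h2.tsum_prod.trans ((Equiv.neg ℤ).tsum_eq
      fun n : ℤ => ∑' a : ℤ, doubleAppellTerm m τ u (-w) z' (a, n)).symm
  have s1 : Summable fun n : ℤ => ∑' a : ℤ, doubleAppellTerm m τ u w z (a, n) := h1.prod
  have s2 : Summable fun n : ℤ => ∑' a : ℤ, doubleAppellTerm m τ u (-w) z' (a, -n) :=
    (Equiv.neg ℤ).summable_iff.2 h2.prod
  rw [i1, i2, ← s1.tsum_add s2]
  have key : ∀ n : ℤ, ∑' a : ℤ, doubleAppellTerm m τ u w z (a, n) +
      ∑' a : ℤ, doubleAppellTerm m τ u (-w) z' (a, -n) =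
      qexp (n * (m * w) + m * n ^ 2 * τ) * S -
        qexp (n * (z - z' + m * w) + (m + 1 : ℝ) * n ^ 2 * τ) * (I * κ) := by
    intro n
    have hzn := hz.add_int_mul n
    have hzn' := hz'.sub_int_mul n
    have hun : z + n * τ + (z' - n * τ) = u := by rw [← hu]; ring
    have j1 : ∑' a : ℤ, doubleAppellTerm m τ u w z (a, n) = qexp (n * (m * w) + m * n ^ 2 * τ) *
        ∑' a : ℤ, qexp (a * u + a ^ 2 * τ) * (1 - qexp (z + n * τ + a * τ))⁻¹ := by
      rw [← tsum_mul_left]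
      refine tsum_congr fun a => ?_
      rw [doubleAppellTerm, show z + (((a, n) : ℤ × ℤ).1 + ((a, n) : ℤ × ℤ).2) * τ =
        z + n * τ + a * τ by ring]
      ring
    have j2 : ∑' a : ℤ, doubleAppellTerm m τ u (-w) z' (a, -n) =
        qexp (n * (m * w) + m * n ^ 2 * τ) *
        ∑' a : ℤ, qexp (a * u + a ^ 2 * τ) * (1 - qexp (z' - n * τ + a * τ))⁻¹ := by
      rw [← tsum_mul_left]
      refine tsum_congr fun a => ?_
      rw [doubleAppellTerm]
      simp only []
      rw [show z' + (a + ((-n : ℤ) : ℂ)) * τ = z' - n * τ + a * τ by push_cast; ring,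
        show ((-n : ℤ) : ℂ) * (m * -w) + m * ((-n : ℤ) : ℂ) ^ 2 * τ =
          n * (m * w) + m * n ^ 2 * τ by push_cast; ring]
      ring
    have j3 := appellSum_eq hτ hzn hzn'
    have j4 := appellSum_mul_mumfordTheta hτ hzn hzn'
    rw [hun] at j3 j4
    have t1 := mumfordTheta_add_int_mul τ z n
    have t2 := mumfordTheta_add_int_mul τ z' (-n)
    rw [show z' + ((-n : ℤ) : ℂ) * τ = z' - n * τ by push_cast; ring] at t2
    have j5 : appellSum τ (z + n * τ) (z' - n * τ) =
        -(qexp (n * (z - z') + n ^ 2 * τ) * (I * κ)) := by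
      have hne1 := mumfordTheta_ne_zero hτ hz
      have hne2 := mumfordTheta_ne_zero hτ hz'
      have e : qexp (n / 2 - n ^ 2 / 2 * τ - n * z) *
          qexp (((-n : ℤ) : ℂ) / 2 - ((-n : ℤ) : ℂ) ^ 2 / 2 * τ - ((-n : ℤ) : ℂ) * z') =
          (qexp (n * (z - z') + n ^ 2 * τ))⁻¹ := by
        rw [← qexp_add, ← qexp_neg]; congr 1; push_cast; ring
      have hq := qexp_ne_zero (n * (z - z') + n ^ 2 * τ)
      rw [t1, t2] at j4
      have j6 : appellSum τ (z + n * τ) (z' - n * τ) * (qexp (n * (z - z') + n ^ 2 * τ))⁻¹ *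
          (mumfordTheta 1 1 τ z * mumfordTheta 1 1 τ z') =
          -(I * ModularForm.eta τ ^ 3 * mumfordTheta 1 1 τ u) := by
        rw [← e, ← j4]; ring
      rw [hκ]
      generalize qexp (n * (z - z') + n ^ 2 * τ) = y at *
      field_simp at j6 ⊢
      linear_combination j6
    have e2 : qexp (n * (z - z' + m * w) + (m + 1 : ℝ) * n ^ 2 * τ) =
        qexp (n * (m * w) + m * n ^ 2 * τ) * qexp (n * (z - z') + n ^ 2 * τ) := by
      rw [← qexp_add]; congr 1; push_cast; ring
    rw [j1, j2, e2]
    linear_combination qexp (n * (m * w) + m * n ^ 2 * τ) * (j5 - j3)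
  rw [tsum_congr key, Summable.tsum_sub ((summable_qexp hτ hm _).mul_right _)
    ((summable_qexp hτ (by linarith : 0 < m + 1) _).mul_right _), tsum_mul_right, tsum_mul_right,
    thetaSeries, thetaSeries]
  ring

/-- Completing the square: a power of `e(z) q^j` inserted into a theta series gives `θ_{k,m}`. -/
lemma hasSum_mul_zpow {m : ℝ} (hm : 0 < m) {τ : ℂ} (hτ : 0 < τ.im) (w z : ℂ) (k : ℤ) :
    HasSum (fun j : ℤ => qexp (j * (m * w) + m * j ^ 2 * τ) * qexp (z + j * τ) ^ k)
      (qexp (k * (z - w / 2) - k ^ 2 / (4 * m) * τ) * jacobiThetaKM k m τ w) := by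
  have h := ((summable_qexp hτ hm (m * w + k * τ)).hasSum).mul_left (qexp (k * z))
  rw [jacobiThetaKM_eq hm.ne', ← mul_assoc, ← qexp_add]
  have e : (k * (z - w / 2) - k ^ 2 / (4 * m) * τ +
      (((k : ℝ) : ℂ) * w / 2 + ((k : ℝ) : ℂ) ^ 2 / (4 * m) * τ) : ℂ) = k * z := by
    push_cast; ring
  rw [e]
  convert! h using 1
  ext j
  rw [qexp_zpow, ← qexp_add, ← qexp_add]
  congr 1
  ring

/-- The sum over `j` of `e(mjw) q^{mj²} (1 - x^{-2ma}) / (1 - x)`, `x = e(z) q^j`, as a finite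
combination of the functions `θ_{k,m}(w)`; here `N = 2m`. -/
noncomputable def thetaCorrection (m : ℝ) (N : ℕ) (τ w z : ℂ) (a : ℤ) : ℂ :=
  if a ≤ 0 then
    ∑ k ∈ Finset.range (N * a.natAbs),
      qexp (k * (z - w / 2) - k ^ 2 / (4 * m) * τ) * jacobiThetaKM k m τ w
  else
    -∑ k ∈ Finset.Icc 1 (N * a.natAbs),
      qexp (-k * (z - w / 2) - k ^ 2 / (4 * m) * τ) * jacobiThetaKM (-k) m τ w

lemma inv_one_sub_eq_sum_add {x : ℂ} (hx : 1 - x ≠ 0) (n : ℕ) :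
    (1 - x)⁻¹ = ∑ k ∈ Finset.range n, x ^ k + x ^ n * (1 - x)⁻¹ := by
  have := mul_neg_geom_sum x n
  field_simp
  linear_combination -this

lemma inv_one_sub_eq_neg_sum_add {x : ℂ} (hx0 : x ≠ 0) (hx : 1 - x ≠ 0) (n : ℕ) :
    (1 - x)⁻¹ = -∑ k ∈ Finset.Icc 1 n, (x ^ k)⁻¹ + (x ^ n)⁻¹ * (1 - x)⁻¹ := by
  induction n with
  | zero => simp
  | succ n ih =>
    rw [Finset.sum_Icc_succ_top (by omega)]
    have : (x ^ n)⁻¹ * (1 - x)⁻¹ = -(x ^ (n + 1))⁻¹ + (x ^ (n + 1))⁻¹ * (1 - x)⁻¹ := by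
      field_simp
      ring
    linear_combination ih + this

lemma appellLerch_eq_add_thetaCorrection {m : ℝ} (hm : 0 < m) {N : ℕ} {τ : ℂ} (hτ : 0 < τ.im)
    (w : ℂ) {z : ℂ} (hz : OffLattice τ z) (a : ℤ) :
    appellLerch m τ w z = ∑' j : ℤ, qexp (j * (m * w) + m * j ^ 2 * τ) *
        qexp (z + j * τ) ^ (-(N * a)) * (1 - qexp (z + j * τ))⁻¹
      + thetaCorrection m N τ w z a := by
  obtain ⟨C, hC⟩ := hz.exists_bound hτ
  have hs := (hasSum_mul_zpow hm hτ w z (-(N * a))).summable.mul_bounded hC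
  rw [appellLerch, thetaCorrection]
  split_ifs with ha
  · obtain ⟨n, rfl⟩ : ∃ n : ℕ, a = -n := ⟨a.natAbs, by omega⟩
    have hfin := hasSum_sum (s := Finset.range (N * n))
      fun k _ => hasSum_mul_zpow hm hτ w z ((k : ℕ) : ℤ)
    have htot := hs.hasSum.add hfin
    simp only [Int.natAbs_neg, Int.natAbs_natCast]
    have hv := htot.tsum_eq
    simp only [Int.cast_natCast] at hv
    rw [← hv]
    refine tsum_congr fun j => ?_
    have h1 := inv_one_sub_eq_sum_add (offLattice_iff.1 hz j) (N * n)
    have h2 : qexp (z + j * τ) ^ (-((N : ℤ) * -(n : ℤ))) = qexp (z + j * τ) ^ (N * n) := by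
      rw [← zpow_natCast]; congr 1; push_cast; ring
    simp only [zpow_natCast]
    rw [h2, ← Finset.mul_sum]
    linear_combination qexp (j * (m * w) + m * j ^ 2 * τ) * h1
  · obtain ⟨n, rfl⟩ : ∃ n : ℕ, a = n := ⟨a.natAbs, by omega⟩
    have hfin := hasSum_sum (s := Finset.Icc 1 (N * n))
      fun k _ => hasSum_mul_zpow hm hτ w z (-((k : ℕ) : ℤ))
    have htot := hs.hasSum.add hfin.neg
    simp only [Int.natAbs_natCast]
    have hv := htot.tsum_eq
    simp only [Int.cast_natCast, Int.cast_neg, neg_sq] at hv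
    rw [← hv]
    refine tsum_congr fun j => ?_
    have h1 := inv_one_sub_eq_neg_sum_add (qexp_ne_zero _) (offLattice_iff.1 hz j) (N * n)
    have h2 : qexp (z + j * τ) ^ (-((N : ℤ) * (n : ℤ))) = (qexp (z + j * τ) ^ (N * n))⁻¹ := by
      rw [zpow_neg, ← zpow_natCast]; congr 2
    simp only [zpow_neg, zpow_natCast] at h2 ⊢
    rw [h2, ← Finset.mul_sum]
    linear_combination qexp (j * (m * w) + m * j ^ 2 * τ) * h1

/-- The product of `Θ_{m+1}` with an Appell sum of level `m` is a double series of level `(1, m)` up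
to finite theta corrections: with `x = e(z) q^j`, the exponent `K = -2ma` in
`1/(1 - x) = (1 - x^K)/(1 - x) + x^K/(1 - x)` is the one for which the substitution `j = a + n`
diagonalises the quadratic form. -/
lemma hasSum_thetaCorrection {m : ℝ} (hm : 0 < m) {N : ℕ} (hN : 2 * m = N) {τ : ℂ}
    (hτ : 0 < τ.im) (u w : ℂ) {z : ℂ} (hz : OffLattice τ z) :
    HasSum (fun a : ℤ => qexp (a * (u + m * (2 * z - w)) + (m + 1 : ℝ) * a ^ 2 * τ) *
        thetaCorrection m N τ w z a)
      (thetaSeries (m + 1) τ (u + m * (2 * z - w)) * appellLerch m τ w z -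
        doubleAppell m τ u w z) := by
  have h1 := ((summable_qexp hτ (by linarith : 0 < m + 1)
    (u + m * (2 * z - w))).hasSum).mul_right (appellLerch m τ w z)
  have hs := summable_doubleAppellTerm hm hτ u w hz
  have h2 : HasSum (fun a : ℤ => ∑' n : ℤ, doubleAppellTerm m τ u w z (a, n))
      (doubleAppell m τ u w z) := by
    rw [doubleAppell, hs.tsum_prod]
    exact hs.prod.hasSum
  have hN' : (N : ℂ) = 2 * m := by exact_mod_cast hN.symm
  convert! h1.sub h2 using 1
  ext a
  rw [appellLerch_eq_add_thetaCorrection hm hτ w hz a (N := N),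
    ← (Equiv.subRight a).tsum_eq fun n : ℤ => doubleAppellTerm m τ u w z (a, n)]
  suffices h : ∀ j : ℤ, doubleAppellTerm m τ u w z (a, Equiv.subRight a j) =
      qexp (a * (u + m * (2 * z - w)) + (m + 1 : ℝ) * a ^ 2 * τ) *
        (qexp (j * (m * w) + m * j ^ 2 * τ) * qexp (z + j * τ) ^ (-(N * a) : ℤ) *
          (1 - qexp (z + j * τ))⁻¹) by
    rw [tsum_congr h, tsum_mul_left]
    ring
  intro j
  rw [doubleAppellTerm]
  simp only [Equiv.subRight_apply]
  rw [show z + ((a : ℂ) + ((j - a : ℤ) : ℂ)) * τ = z + j * τ by push_cast; ring, ← mul_assoc,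
    ← mul_assoc, qexp_zpow, ← qexp_add, ← qexp_add, ← qexp_add]
  congr 2
  push_cast
  rw [hN']
  ring

/-! ### The double sum -/

/-- The difference, at `a = -j`, of two theta corrections with the same value of `2z - w`. -/
lemma thetaCorrection_neg_sub {m : ℝ} (hm : 0 < m) (N : ℕ) (τ w z z' : ℂ)
    (hz : 2 * z - w = 2 * z' + w) (j : ℕ) :
    thetaCorrection m N τ w z (-j) - thetaCorrection m N τ (-w) z' (-j) =
      ∑ k ∈ Finset.range (N * j), qexp (k * ((2 * z - w) / 2) - k ^ 2 / (4 * m) * τ) *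
        (jacobiThetaKM k m τ w - jacobiThetaKM (-k) m τ w) := by
  rw [thetaCorrection, thetaCorrection, if_pos (by omega), if_pos (by omega), Int.natAbs_neg,
    Int.natAbs_natCast, ← Finset.sum_sub_distrib]
  refine Finset.sum_congr rfl fun k _ => ?_
  rw [show z - w / 2 = (2 * z - w) / 2 by ring, show z' - -w / 2 = (2 * z' + w) / 2 by ring, ← hz,
    jacobiThetaKM_neg hm.ne']
  ring

lemma thetaCorrection_sub {m : ℝ} (hm : 0 < m) (N : ℕ) (τ w z z' : ℂ)
    (hz : 2 * z - w = 2 * z' + w) {j : ℕ} (hj : 0 < j) :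
    thetaCorrection m N τ w z j - thetaCorrection m N τ (-w) z' j =
      ∑ k ∈ Finset.Icc 1 (N * j), qexp (-k * ((2 * z - w) / 2) - k ^ 2 / (4 * m) * τ) *
        (jacobiThetaKM k m τ w - jacobiThetaKM (-k) m τ w) := by
  rw [thetaCorrection, thetaCorrection, if_neg (by omega), if_neg (by omega),
    Int.natAbs_natCast, sub_neg_eq_add, neg_add_eq_sub, ← Finset.sum_sub_distrib]
  refine Finset.sum_congr rfl fun k _ => ?_
  rw [show z - w / 2 = (2 * z - w) / 2 by ring, show z' - -w / 2 = (2 * z' + w) / 2 by ring, ← hz,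
    jacobiThetaKM_neg hm.ne' k τ w, jacobiThetaKM_neg hm.ne' k τ (-w), neg_neg]
  ring

/-- The contributions of `a = j` and `a = -j` to the four theta corrections add up to the `j`-th
term of the double sum. The terms `k = 0` drop out because `θ_0` is even, and the terms `k = 2mj`
because they do not depend on `r` and `p`. -/
lemma thetaCorrection_total {m : ℝ} (hm : 0 < m) {N : ℕ} (hN : 2 * m = N)
    (τ z₁ z₂ z₃ : ℂ) (j : ℕ+) (D : ℂ → ℂ → ℤ → ℂ)
    (hD : ∀ w z a, D w z a =
      qexp (a * (z₁ - z₂ + m * (2 * z - w)) + (m + 1 : ℝ) * a ^ 2 * τ) *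
        thetaCorrection m N τ w z a) :
    (D (z₁ - z₃) z₁ j - D (-(z₁ - z₃)) z₃ j - D (z₁ - z₃) (z₁ - z₂ - z₃) j +
        D (-(z₁ - z₃)) (-z₂) j) +
      (D (z₁ - z₃) z₁ (-j) - D (-(z₁ - z₃)) z₃ (-j) - D (z₁ - z₃) (z₁ - z₂ - z₃) (-j) +
        D (-(z₁ - z₃)) (-z₂) (-j)) =
      -doubleSumTerm m N τ z₁ z₂ z₃ j := by
  have hN' : (N : ℂ) = 2 * m := by exact_mod_cast hN.symm
  have hmC : (m : ℂ) ≠ 0 := by exact_mod_cast hm.ne'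
  obtain ⟨j, hj⟩ := j
  simp only [PNat.mk_coe]
  set w := z₁ - z₃ with hw
  have hr1 : 2 * z₁ - w = z₁ + z₃ := by rw [hw]; ring
  have hr2 : 2 * z₃ - -w = z₁ + z₃ := by rw [hw]; ring
  have hp1 : 2 * (z₁ - z₂ - z₃) - w = z₁ - 2 * z₂ - z₃ := by rw [hw]; ring
  have hp2 : 2 * -z₂ - -w = z₁ - 2 * z₂ - z₃ := by rw [hw]; ring
  have n1 := thetaCorrection_neg_sub hm N τ w z₁ z₃ (by rw [hw]; ring) j
  have n2 := thetaCorrection_neg_sub hm N τ w (z₁ - z₂ - z₃) (-z₂) (by rw [hw]; ring) j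
  have p1 := thetaCorrection_sub hm N τ w z₁ z₃ (by rw [hw]; ring) hj
  have p2 := thetaCorrection_sub hm N τ w (z₁ - z₂ - z₃) (-z₂) (by rw [hw]; ring) hj
  simp only [hD, hr1, hr2, hp1, hp2] at n1 n2 p1 p2 ⊢
  set r := z₁ + z₃ with hr
  set p := z₁ - 2 * z₂ - z₃ with hp
  set u := z₁ - z₂ with hu
  set V : ℂ → ℕ → ℂ := fun x k => qexp (-j * (u + m * x) + (m + 1 : ℝ) * j ^ 2 * τ) *
    (qexp (k * (x / 2) - k ^ 2 / (4 * m) * τ) *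
      (jacobiThetaKM k m τ w - jacobiThetaKM (-k) m τ w)) with hV
  have hrange : ∑ k ∈ Finset.range (N * j), (V r k - V p k) =
      ∑ k ∈ Finset.Icc 1 (N * j), (V r k - V p k) := by
    have h0 : V r 0 - V p 0 = 0 := by
      simp [hV]
    have h1 : V r (N * j) - V p (N * j) = 0 := by
      have : ∀ x : ℂ, V x (N * j) = qexp (-j * u + j ^ 2 * τ) *
          (jacobiThetaKM ((N * j : ℕ) : ℝ) m τ w - jacobiThetaKM (-((N * j : ℕ) : ℝ)) m τ w) := by
        intro x
        simp only [hV]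
        rw [← mul_assoc, ← qexp_add]
        congr 2
        push_cast
        rw [hN']
        field_simp
        ring
      rw [this, this, sub_self]
    have e1 := Finset.sum_range_succ (fun k => V r k - V p k) (N * j)
    have e2 := Finset.sum_range_succ' (fun k => V r k - V p k) (N * j)
    rw [h1, add_zero] at e1
    rw [h0, add_zero] at e2
    rw [← e1, e2, Finset.range_eq_Ico, Finset.sum_Ico_add' (fun k => V r k - V p k) 0 (N * j) 1]
    rfl
  have c1 : qexp (-j * (u + m * r) + (m + 1 : ℝ) * j ^ 2 * τ) *
        (thetaCorrection m N τ w z₁ (-j) - thetaCorrection m N τ (-w) z₃ (-j)) -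
      qexp (-j * (u + m * p) + (m + 1 : ℝ) * j ^ 2 * τ) *
        (thetaCorrection m N τ w (z₁ - z₂ - z₃) (-j) - thetaCorrection m N τ (-w) (-z₂) (-j)) =
      ∑ k ∈ Finset.Icc 1 (N * j), (V r k - V p k) := by
    rw [← hrange, n1, n2, Finset.sum_sub_distrib, Finset.mul_sum, Finset.mul_sum]
  have c2 : qexp (j * (u + m * r) + (m + 1 : ℝ) * j ^ 2 * τ) *
        (thetaCorrection m N τ w z₁ j - thetaCorrection m N τ (-w) z₃ j) -
      qexp (j * (u + m * p) + (m + 1 : ℝ) * j ^ 2 * τ) *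
        (thetaCorrection m N τ w (z₁ - z₂ - z₃) j - thetaCorrection m N τ (-w) (-z₂) j) +
      ∑ k ∈ Finset.Icc 1 (N * j), (V r k - V p k) = -doubleSumTerm m N τ z₁ z₂ z₃ j := by
    rw [p1, p2, Finset.mul_sum, Finset.mul_sum, ← Finset.sum_sub_distrib, ← Finset.sum_add_distrib,
      doubleSumTerm, ← Finset.sum_neg_distrib]
    refine Finset.sum_congr rfl fun k _ => ?_
    have hc : ∀ x : ℂ, qpow τ ((m + 1) * j ^ 2) * qpow τ (-(k ^ 2 / (4 * m))) *
        (cexp (2 * Real.pi * I * j * u) * cexp (Real.pi * I * (2 * m * j - k) * x)) =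
        qexp (j * (u + m * x) + (m + 1 : ℝ) * j ^ 2 * τ) *
          qexp (-k * (x / 2) - k ^ 2 / (4 * m) * τ) := by
      intro x
      simp only [qpow_eq, qexp, ← Complex.exp_add]
      congr 1
      push_cast
      ring
    have hc' : ∀ x : ℂ, qpow τ ((m + 1) * j ^ 2) * qpow τ (-(k ^ 2 / (4 * m))) *
        (cexp (-2 * Real.pi * I * j * u) * cexp (-Real.pi * I * (2 * m * j - k) * x)) =
        qexp (-j * (u + m * x) + (m + 1 : ℝ) * j ^ 2 * τ) *
          qexp (k * (x / 2) - k ^ 2 / (4 * m) * τ) := by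
      intro x
      simp only [qpow_eq, qexp, ← Complex.exp_add]
      congr 1
      push_cast
      ring
    simp only [coeffP, hV, ← hu, ← hr, ← hp, ← hw]
    linear_combination (jacobiThetaKM k m τ w - jacobiThetaKM (-k) m τ w) *
      (hc p + hc' p - hc r - hc' r)
  have e3 : (((-(j : ℤ)) : ℤ) : ℂ) = -(j : ℂ) := by push_cast; rfl
  simp only [e3, neg_sq]
  linear_combination c1 + c2

theorem mainTheorem2 (m : ℝ) (N : ℕ) (hN : 0 < N) (hm : 2 * m = N)
    (τ : ℂ) (hτ : 0 < τ.im) (z₁ z₂ z₃ : ℂ)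
    (h₁ : OffLattice τ z₁) (h₂ : OffLattice τ z₂) (h₃ : OffLattice τ z₃)
    (h₄ : OffLattice τ (z₁ - z₂ - z₃)) :
    Summable (fun j : ℕ+ => doubleSumTerm m N τ z₁ z₂ z₃ j) ∧
    jacobiThetaKM 0 (m + 1) τ (((z₁ - z₂) + m * (z₁ + z₃)) / (m + 1)) *
        mockPhi m 0 τ z₁ (-z₃) 0
      - jacobiThetaKM 0 (m + 1) τ (((z₁ - z₂) + m * (z₁ - 2 * z₂ - z₃)) / (m + 1)) *
        mockPhi m 0 τ z₂ (z₁ - z₂ - z₃) 0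
      + ∑' j : ℕ+, doubleSumTerm m N τ z₁ z₂ z₃ j
    = I * jacobiThetaKM 0 (m + 1) τ (((z₁ + z₂) + m * (z₁ - z₃)) / (m + 1)) *
        (ModularForm.eta τ ^ 3 * mumfordTheta 1 1 τ (z₁ - z₂) /
          (mumfordTheta 1 1 τ z₁ * mumfordTheta 1 1 τ z₂))
      + I * jacobiThetaKM 0 (m + 1) τ (((z₁ - z₂ - 2 * z₃) + m * (z₁ - z₃)) / (m + 1)) *
        (ModularForm.eta τ ^ 3 * mumfordTheta 1 1 τ (z₁ - z₂) /
          (mumfordTheta 1 1 τ z₃ * mumfordTheta 1 1 τ (z₁ - z₂ - z₃))) := by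
  have hm0 : 0 < m := by
    have : (0 : ℝ) < N := by exact_mod_cast hN
    linarith
  have hθ : ∀ x : ℂ, jacobiThetaKM 0 (m + 1) τ (x / (m + 1)) = thetaSeries (m + 1) τ x := by
    intro x
    have := jacobiThetaKM_zero (by linarith : m + 1 ≠ 0) τ x
    push_cast at this
    exact this
  set w := z₁ - z₃ with hw
  -- One Appell sum for each of the four theta factors in the denominators of the right-hand side.
  have s1 := hasSum_thetaCorrection hm0 hm hτ (z₁ - z₂) w h₁
  have s2 := hasSum_thetaCorrection hm0 hm hτ (z₁ - z₂) (-w) h₃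
  have s3 := hasSum_thetaCorrection hm0 hm hτ (z₁ - z₂) w h₄
  have s4 := hasSum_thetaCorrection hm0 hm hτ (z₁ - z₂) (-w) h₂.neg
  obtain ⟨D, hD⟩ : ∃ D : ℂ → ℂ → ℤ → ℂ, ∀ w z a, D w z a =
      qexp (a * (z₁ - z₂ + m * (2 * z - w)) + (m + 1 : ℝ) * a ^ 2 * τ) *
        thetaCorrection m N τ w z a := ⟨_, fun _ _ _ => rfl⟩
  simp only [← hD] at s1 s2 s3 s4
  have hs := ((s1.sub s2).sub s3).add s4
  have hterm := thetaCorrection_total hm0 hm τ z₁ z₂ z₃ (D := D) (hD := hD)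
  have hz0 : ∀ w z, D w z 0 = 0 := by
    intro w z
    rw [hD, thetaCorrection]
    simp
  have hpos := hs.summable.comp_injective (i := fun j : ℕ+ => ((j : ℕ) : ℤ))
    (fun a b h => by simpa using h)
  have hneg := hs.summable.comp_injective (i := fun j : ℕ+ => -((j : ℕ) : ℤ))
    (fun a b h => by simpa using h)
  have htot : (fun j : ℕ+ => -doubleSumTerm m N τ z₁ z₂ z₃ j) = fun j : ℕ+ =>
      (D w z₁ (j : ℕ) - D (-w) z₃ (j : ℕ) - D w (z₁ - z₂ - z₃) (j : ℕ) + D (-w) (-z₂) (j : ℕ)) +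
      (D w z₁ (-(j : ℕ)) - D (-w) z₃ (-(j : ℕ)) - D w (z₁ - z₂ - z₃) (-(j : ℕ)) +
        D (-w) (-z₂) (-(j : ℕ))) :=
    funext fun j => (hterm j).symm
  have hsummable : Summable fun j : ℕ+ => -doubleSumTerm m N τ z₁ z₂ z₃ j := by
    rw [htot]
    exact hpos.add hneg
  refine ⟨summable_neg_iff.1 hsummable, ?_⟩
  have hsum := hs.tsum_eq
  rw [tsum_int_eq_zero_add_tsum_pnat hs.summable] at hsum
  have hsum2 := hpos.tsum_add hneg
  simp only [Function.comp_apply] at hsum2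
  rw [← htot, tsum_neg] at hsum2
  simp only [hz0] at hsum
  -- The sums `z₁ + (-z₂)` and `z₃ + z₄` both equal `u`, and the theta products in the two results
  -- cancel because they are even in `w`.
  have a1 := doubleAppell_add hm0 hτ w h₁ h₂.neg (u := z₁ - z₂) (by ring)
  have a2 := doubleAppell_add hm0 hτ (-w) h₃ h₄ (u := z₁ - z₂) (by ring)
  rw [neg_neg] at a2
  have hΘ0 : thetaSeries m τ (m * -w) = thetaSeries m τ (m * w) := by
    rw [mul_neg, thetaSeries_neg]
  have hΘ1 : thetaSeries (m + 1) τ (z₃ - (z₁ - z₂ - z₃) + m * -w) =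
      thetaSeries (m + 1) τ (z₁ - z₂ - 2 * z₃ + m * w) := by
    rw [← thetaSeries_neg]
    congr 1
    ring
  rw [hΘ0, hΘ1] at a2
  rw [sub_neg_eq_add, mumfordTheta_neg] at a1
  rw [hθ, hθ, hθ, hθ, mockPhi_eq, mockPhi_eq, neg_neg, ← sub_eq_add_neg, ← hw,
    show z₂ + (z₁ - z₂ - z₃) = w by rw [hw]; ring]
  -- These reflections replace the pair of Appell sums in the second `Φ` by the one expanded above.
  have f1 := appellLerch_neg_neg hm0 hτ w h₄
  have f2 := appellLerch_neg_neg hm0 hτ w h₂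
  rw [show 2 * z₁ - w = z₁ + z₃ by rw [hw]; ring, show 2 * z₃ - -w = z₁ + z₃ by rw [hw]; ring,
    show 2 * (z₁ - z₂ - z₃) - w = z₁ - 2 * z₂ - z₃ by rw [hw]; ring,
    show 2 * -z₂ - -w = z₁ - 2 * z₂ - z₃ by rw [hw]; ring] at hsum
  rw [mul_neg, div_neg] at a1
  linear_combination -hsum - hsum2 + a1 - a2 +
    thetaSeries (m + 1) τ (z₁ - z₂ + m * (z₁ - 2 * z₂ - z₃)) * (f1 - f2)
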